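/- Let $n\ge 1$, $A\in\mathbb R^{n\times n}$, $B\in\mathbb R^{n\times m}$, $C\in\mathbb R^{k\times n}$, $F\in\mathbb R^{\ell\times n}$, $x_0\in\mathbb R^n$, $y_c\in\mathbb R^k$, $y_e\in\mathbb R^\ell$, and let $\|\cdot\|$ be the Euclidean norm. For $t_1>0$ consider the finite-horizon problem of minimizing $$\frac12\int_0^{t_1}\|Cx(s)-y_c\|^2+\|u(s)\|^2\,ds+\frac12\|Fx(t_1)-y_e\|^2$$ over $u\in L^2(0,t_1;\mathbb R^m)$ subject to $\dot x=Ax+Bu$, $x(0)=x_0$, and the steady-state problem of minimizing $\frac12\|Cx-y_c\|^2+\frac12\|u\|^2$ over $(x,u)\in\mathbb R^n\times\mathbb R^m$ subject to $0=Ax+Bu$. Assume that the algebraic Riccati equation $A^*X+XA-XBB^*X+C^*C=0$ has a stabilizing solution $P_+\in\mathbb R^{n\times n}$, i.e. all eigenvalues of $A_+:=A-BB^*P_+$ have negative real part. Let $W:=\int_0^\infty e^{sA_+}BB^*e^{sA_+^*}\,ds$ and $S:=F^*F$, and assume that $I+W(S-P_+)$ is invertible. (Detectability of $(C,A)$ is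 not assumed.) Let $\lambda$ be the spectral abscissa of $A_+$, i.e. the maximal real part of its eigenvalues. Then $\lambda<0$; the steady-state problem has a unique solution $(x_s,u_s)$; for every $t_1>0$ the finite-horizon problem has a solution $(x,u)$ with $u$ continuous on $[0,t_1]$, and it is unique ($u$ up to null sets). Moreover the finite-horizon problem has the exponential turnpike property at $(x_s,u_s)$: 1. for every $r$ with $\lambda<r<0$ there is a constant $c>0$, independent of $t_1$ and $t$, such that for all $t_1>0$ and $0\le t\le t_1$ the solution $(x,u)$ (with $u$ continuous) satisfies $$\|x(t)-x_s\|\le c\,(e^{rt}+e^{r(t_1-t)})\quad\text{and}\quad\|u(t)-u_s\|\le c\,(e^{rt}+e^{r(t_1-t)});$$ 2. if the eigenvalues of $A_+$ with real part $\lambda$ are semisimple (their generalized eigenspaces coincide with their eigenspaces), the same holds with $r=\lambda$. -/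

import Mathlib

open MeasureTheory Set

noncomputable section

/-- The data of an affine linear-quadratic regulator problem with state dimension `n`, input
dimension `m`, output dimension `k` and terminal output dimension `l`: the coefficient matrices
`A`, `B`, `C`, `F`, the initial value `x₀` and the target outputs `yc` (running), `ye` (terminal).
Vectors live in Euclidean spaces, so that `‖·‖` is the Euclidean norm. -/
structure AffineLQR (n m k l : ℕ) where
  A : Matrix (Fin n) (Fin n) ℝ
  B : Matrix (Fin n) (Fin m) ℝ
  C : Matrix (Fin k) (Fin n) ℝ
  F : Matrix (Fin l) (Fin n) ℝ
  x₀ : EuclideanSpace ℝ (Fin n)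
  yc : EuclideanSpace ℝ (Fin k)
  ye : EuclideanSpace ℝ (Fin l)

/-- The spectral abscissa of a real square matrix: the maximal real part of its complex
eigenvalues. -/
def spectralAbscissa {n : ℕ} (M : Matrix (Fin n) (Fin n) ℝ) : ℝ :=
  sSup (Complex.re '' spectrum ℂ (M.map (fun a : ℝ => (a : ℂ))))

/-- All complex eigenvalues of the real matrix `M` have negative real part. -/
def IsStableMatrix {n : ℕ} (M : Matrix (Fin n) (Fin n) ℝ) : Prop :=
  ∀ z ∈ spectrum ℂ (M.map (fun a : ℝ => (a : ℂ))), z.re < 0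

/-- Every complex eigenvalue of `M` whose real part equals the spectral abscissa is semisimple,
i.e. its generalized eigenspace coincides with its eigenspace. -/
def HasSemisimpleAbscissa {n : ℕ} (M : Matrix (Fin n) (Fin n) ℝ) : Prop :=
  ∀ z : ℂ, z.re = spectralAbscissa M →
    Module.End.maxGenEigenspace (Matrix.toLin' (M.map (fun a : ℝ => (a : ℂ)))) z =
      Module.End.eigenspace (Matrix.toLin' (M.map (fun a : ℝ => (a : ℂ)))) z

namespace AffineLQR

variable {n m k l : ℕ} (D : AffineLQR n m k l)

/-! ### The finite horizon problem -/

/-- `(x, u)` is an admissible state/control pair on `[0, t₁]`: the control is square integrable,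
and the state is the (absolutely continuous) solution of `x' = A x + B u`, `x 0 = x₀`, in
integrated form. Values outside `[0, t₁]` are irrelevant. -/
structure IsAdmissible (t₁ : ℝ) (x : ℝ → EuclideanSpace ℝ (Fin n))
    (u : ℝ → EuclideanSpace ℝ (Fin m)) : Prop where
  memLp_control : MemLp u 2 (volume.restrict (Icc 0 t₁))
  continuousOn_state : ContinuousOn x (Icc 0 t₁)
  state_eq : ∀ t ∈ Icc 0 t₁,
    x t = D.x₀ + ∫ s in (0 : ℝ)..t, (Matrix.toEuclideanLin D.A (x s) +
      Matrix.toEuclideanLin D.B (u s))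

/-- The finite horizon cost functional. -/
def cost (t₁ : ℝ) (x : ℝ → EuclideanSpace ℝ (Fin n)) (u : ℝ → EuclideanSpace ℝ (Fin m)) : ℝ :=
  1 / 2 * (∫ s in (0 : ℝ)..t₁, (‖Matrix.toEuclideanLin D.C (x s) - D.yc‖ ^ 2 + ‖u s‖ ^ 2)) +
    1 / 2 * ‖Matrix.toEuclideanLin D.F (x t₁) - D.ye‖ ^ 2

/-- `(x, u)` solves the finite horizon optimal control problem on `[0, t₁]`. -/
def IsOptimal (t₁ : ℝ) (x : ℝ → EuclideanSpace ℝ (Fin n))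
    (u : ℝ → EuclideanSpace ℝ (Fin m)) : Prop :=
  D.IsAdmissible t₁ x u ∧ ∀ x' u', D.IsAdmissible t₁ x' u' → D.cost t₁ x u ≤ D.cost t₁ x' u'

/-! ### The steady-state problem -/

/-- The steady-state constraint `0 = A x + B u`. -/
def IsSteadyState (x : EuclideanSpace ℝ (Fin n)) (u : EuclideanSpace ℝ (Fin m)) : Prop :=
  Matrix.toEuclideanLin D.A x + Matrix.toEuclideanLin D.B u = 0

/-- The steady-state cost functional. -/
def steadyCost (x : EuclideanSpace ℝ (Fin n)) (u : EuclideanSpace ℝ (Fin m)) : ℝ :=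
  1 / 2 * ‖Matrix.toEuclideanLin D.C x - D.yc‖ ^ 2 + 1 / 2 * ‖u‖ ^ 2

/-- `(x, u)` solves the steady-state optimal control problem. -/
def IsSteadyOptimal (x : EuclideanSpace ℝ (Fin n)) (u : EuclideanSpace ℝ (Fin m)) : Prop :=
  D.IsSteadyState x u ∧ ∀ x' u', D.IsSteadyState x' u' → D.steadyCost x u ≤ D.steadyCost x' u'

/-! ### The algebraic Riccati equation and the closed loop -/

/-- The closed-loop matrix `A - B Bᵀ P`. -/
def closedLoop (P : Matrix (Fin n) (Fin n) ℝ) : Matrix (Fin n) (Fin n) ℝ :=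
  D.A - D.B * D.B.transpose * P

/-- `P` is a stabilizing solution of the algebraic Riccati equation
`Aᵀ X + X A - X B Bᵀ X + Cᵀ C = 0`. -/
def IsStabilizingSolution (P : Matrix (Fin n) (Fin n) ℝ) : Prop :=
  D.A.transpose * P + P * D.A - P * D.B * D.B.transpose * P + D.C.transpose * D.C = 0 ∧
    IsStableMatrix (D.closedLoop P)

/-- The closed-loop reachability Gramian `W = ∫₀^∞ exp(s A₊) B Bᵀ exp(s A₊ᵀ) ds` with
`A₊ = A - B Bᵀ P`; the integral is taken entrywise. -/
def gramian (P : Matrix (Fin n) (Fin n) ℝ) : Matrix (Fin n) (Fin n) ℝ :=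
  Matrix.of fun i j => ∫ s in Ioi (0 : ℝ),
    (NormedSpace.exp (s • D.closedLoop P) * D.B * D.B.transpose *
      NormedSpace.exp (s • (D.closedLoop P).transpose)) i j

/-! ### The turnpike estimate -/

/-- The exponential turnpike estimate at `(xs, us)` with rate `r`: there is a constant `c > 0`,
independent of `t` and of the horizon `t₁`, such that every solution `(x, u)` of the finite
horizon problem on every `[0, t₁]` satisfies
`‖x t - xs‖, ‖u t - us‖ ≤ c (exp (r t) + exp (r (t₁ - t)))`. The bound on the state holds for
every `t`; the bound on the control holds for almost every `t`, and for every `t` if the control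
is the continuous representative. -/
def TurnpikeWithRate (xs : EuclideanSpace ℝ (Fin n)) (us : EuclideanSpace ℝ (Fin m))
    (r : ℝ) : Prop :=
  ∃ c : ℝ, 0 < c ∧ ∀ t₁ : ℝ, 0 < t₁ → ∀ x u, D.IsOptimal t₁ x u →
    (∀ t ∈ Icc 0 t₁, ‖x t - xs‖ ≤ c * (Real.exp (r * t) + Real.exp (r * (t₁ - t)))) ∧
    (∀ᵐ t ∂(volume.restrict (Icc 0 t₁)),
      ‖u t - us‖ ≤ c * (Real.exp (r * t) + Real.exp (r * (t₁ - t)))) ∧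
    (ContinuousOn u (Icc 0 t₁) → ∀ t ∈ Icc 0 t₁,
      ‖u t - us‖ ≤ c * (Real.exp (r * t) + Real.exp (r * (t₁ - t))))

end AffineLQR

end

/-! The cost is convex, so a solution of the Hamiltonian system `x' = A x - B B* p`, `p' = -A* p -
C* (C x - yc)`, `p t₁ = F* (F x t₁ - ye)` is optimal: integrating by parts against `p` removes the
linear terms and leaves the quadratic cost of the difference (`IsExtremal.cost_eq`). The term `‖u' -
u‖²` in it also gives uniqueness.

The steady problem has a multiplier `ps` in the same way. Put `z = x - xs` and `q = p - ps - P z`.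
The Riccati equation makes the system triangular: `q' = -A₊* q`, `z' = A₊ z - B B* q`. Hence `q t =
exp ((t₁ - t) A₊*) q₁` and `z t = exp (t A₊) z₀ - W(t) q t` with the finite-time Gramian `W(t)`.
Both decay at the rate of `exp (t A₊)` away from the ends, provided that `q₁` is bounded uniformly
in `t₁`.

The terminal condition reads `(I + (S - P) W(t₁)) q₁ = (S - P) exp (t₁ A₊) z₀ + h` with a fixed `h`.
The operator is invertible for each `t₁`, because the problem with zero data has only the zero
optimum (`eq_zero_of_boundaryOp_eq_zero`). Its limit is invertible by the assumption on `I + W (S -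
P)`. By continuity the inverses are bounded on `[0, ∞)` (`exists_bound_inverse_boundaryOp`).

The admissible rates come from `exists_norm_exp_smul_le`: on generalized eigenvectors `exp (t A₊)`
is an exponential times a polynomial, and the polynomial is constant when the critical eigenvalues
are semisimple. -/

open scoped InnerProductSpace
open ContinuousLinearMap (adjoint)
open NormedSpace Filter Topology

/-! ### Integration by parts for absolutely continuous functions -/

section IntegrationByParts

variable {E : Type*} [NormedAddCommGroup E] [InnerProductSpace ℝ E] [CompleteSpace E]

/-- Integration by parts for the inner product of a `C¹` function and an absolutely continuous
function, the latter given as the primitive of an integrable function. -/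
theorem integral_inner_primitive_add {p p' g : ℝ → E} {T : ℝ} (hT : 0 ≤ T)
    (hp : ∀ t, HasDerivAt p (p' t) t) (hp' : Continuous p')
    (hg : IntervalIntegrable g volume 0 T) :
    ∫ s in (0 : ℝ)..T, (⟪p' s, ∫ τ in (0 : ℝ)..s, g τ⟫_ℝ + ⟪p s, g s⟫_ℝ) =
      ⟪p T, ∫ τ in (0 : ℝ)..T, g τ⟫_ℝ := by
  have hpc : Continuous p := continuous_iff_continuousAt.2 fun t => (hp t).continuousAt
  have hgI : IntegrableOn g (Ioc 0 T) := (intervalIntegrable_iff_integrableOn_Ioc_of_le hT).1 hg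
  have hinner : ∀ q : ℝ → E, Continuous q → IntegrableOn (fun s => ⟪q s, g s⟫_ℝ) (Ioc 0 T) := by
    intro q hq
    obtain ⟨M, hM⟩ := isCompact_Icc.exists_bound_of_continuousOn (s := Icc (0 : ℝ) T)
      hq.continuousOn
    refine (hgI.norm.const_mul M).mono'
      (hq.aestronglyMeasurable.inner hgI.aestronglyMeasurable) ?_
    filter_upwards [ae_restrict_mem measurableSet_Ioc] with s hs
    exact (norm_inner_le_norm _ _).trans
      (mul_le_mul_of_nonneg_right (hM s (Ioc_subset_Icc_self hs)) (norm_nonneg _))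
  have hprim : ContinuousOn (fun s => ∫ τ in (0 : ℝ)..s, g τ) (Icc 0 T) := by
    have := intervalIntegral.continuousOn_primitive_interval
      (f := g) (μ := volume) (a := 0) (b := T)
      (by rwa [uIcc_of_le hT, integrableOn_Icc_iff_integrableOn_Ioc])
    rwa [uIcc_of_le hT] at this
  have hI1 : IntervalIntegrable (fun s => ⟪p' s, ∫ τ in (0 : ℝ)..s, g τ⟫_ℝ) volume 0 T :=
    ContinuousOn.intervalIntegrable_of_Icc hT (hp'.continuousOn.inner hprim)
  have hI2 : IntervalIntegrable (fun s => ⟪p s, g s⟫_ℝ) volume 0 T :=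
    (intervalIntegrable_iff_integrableOn_Ioc_of_le hT).2 (hinner p hpc)
  rw [intervalIntegral.integral_add hI1 hI2]
  set μ : Measure ℝ := volume.restrict (Ioc 0 T) with hμ
  -- As `g` is only integrable, its primitive need not be differentiable everywhere. Fubini on the
  -- triangle `τ ≤ s` takes the place of the product rule.
  set K : ℝ → ℝ → ℝ := fun s τ => {z : ℝ × ℝ | z.2 ≤ z.1}.indicator
    (fun z => ⟪p' z.1, g z.2⟫_ℝ) (s, τ) with hK
  have hKint : Integrable (Function.uncurry K) (μ.prod μ) := by
    have h1 : Integrable (fun z : ℝ × ℝ => ⟪p' z.1, g z.2⟫_ℝ) (μ.prod μ) := by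
      have h2 : Integrable (fun z : ℝ × ℝ => ‖p' z.1‖ * ‖g z.2‖) (μ.prod μ) := by
        refine Integrable.mul_prod (f := fun s => ‖p' s‖) (g := fun s => ‖g s‖) ?_ hgI.norm
        exact (hp'.norm.continuousOn.integrableOn_Icc (a := 0) (b := T)).mono_set Ioc_subset_Icc_self
      refine h2.mono' ?_ (Filter.Eventually.of_forall fun z => norm_inner_le_norm _ _)
      exact (hp'.aestronglyMeasurable.comp_fst).inner hgI.aestronglyMeasurable.comp_snd
    exact h1.indicator (measurableSet_le measurable_snd measurable_fst)
  have hswap := integral_integral_swap hKint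
  have hL : ∫ s in (0 : ℝ)..T, ⟪p' s, ∫ τ in (0 : ℝ)..s, g τ⟫_ℝ = ∫ s, ∫ τ, K s τ ∂μ ∂μ := by
    rw [intervalIntegral.integral_of_le hT]
    refine setIntegral_congr_fun measurableSet_Ioc fun s hs => ?_
    have h3 : (fun τ => K s τ) = (Iic s).indicator (fun τ => ⟪p' s, g τ⟫_ℝ) := by
      ext τ; simp [hK, indicator]
    have hgs : IntegrableOn g (Ioc 0 s) := hgI.mono_set (Ioc_subset_Ioc_right hs.2)
    simp only [h3]
    rw [integral_indicator measurableSet_Iic, hμ, Measure.restrict_restrict measurableSet_Iic,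
      show Iic s ∩ Ioc 0 T = Ioc 0 s by ext τ; simp; grind [hs.2],
      intervalIntegral.integral_of_le hs.1.le]
    exact (integral_inner hgs (p' s)).symm
  have hR : ∫ τ, ∫ s, K s τ ∂μ ∂μ = ∫ τ in (0 : ℝ)..T, ⟪p T - p τ, g τ⟫_ℝ := by
    rw [intervalIntegral.integral_of_le hT]
    refine setIntegral_congr_fun measurableSet_Ioc fun τ hτ => ?_
    have h3 : (fun s => K s τ) = (Ici τ).indicator (fun s => ⟪p' s, g τ⟫_ℝ) := by
      ext s; simp [hK, indicator]
    simp only [h3]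
    rw [integral_indicator measurableSet_Ici, hμ, Measure.restrict_restrict measurableSet_Ici,
      show Ici τ ∩ Ioc 0 T = Icc τ T by ext s; simp; grind [hτ.1],
      integral_Icc_eq_integral_Ioc, ← intervalIntegral.integral_of_le hτ.2,
      intervalIntegral.integral_eq_sub_of_hasDerivAt
        (fun s _ => by simpa using (hp s).inner ℝ (hasDerivAt_const s (g τ)))
        ((hp'.inner continuous_const).intervalIntegrable _ _), inner_sub_left]
  have hI3 : IntervalIntegrable (fun τ => ⟪p T - p τ, g τ⟫_ℝ) volume 0 T :=
    (intervalIntegrable_iff_integrableOn_Ioc_of_le hT).2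
      (hinner (fun τ => p T - p τ) (continuous_const.sub hpc))
  rw [hL, hswap, hR, ← intervalIntegral.integral_add hI3 hI2]
  simp only [← inner_add_left, sub_add_cancel]
  rw [intervalIntegral.integral_of_le hT, intervalIntegral.integral_of_le hT]
  exact integral_inner hgI (p T)

end IntegrationByParts

/-! ### Operator exponentials, Lyapunov equations and Gramians -/

section OperatorExponential

variable {E : Type*} [NormedAddCommGroup E] [InnerProductSpace ℝ E] [CompleteSpace E]

theorem continuous_exp_smul {𝔸 : Type*} [NormedRing 𝔸] [NormedAlgebra ℝ 𝔸] [CompleteSpace 𝔸]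
    (M : 𝔸) :
    Continuous fun t : ℝ => exp (t • M) :=
  continuous_iff_continuousAt.2 fun t => (hasDerivAt_exp_smul_const M t).continuousAt

/-- The backward flow, used with an adjoint as `N`: for the decoupled costate, and as a test
function for uniqueness of the state. -/
theorem hasDerivAt_exp_sub_smul_apply {E : Type*} [NormedAddCommGroup E] [NormedSpace ℝ E]
    [CompleteSpace E] (N : E →L[ℝ] E) (t₁ : ℝ) (q : E) (t : ℝ) :
    HasDerivAt (fun s : ℝ => exp ((t₁ - s) • N) q) (-N (exp ((t₁ - t) • N) q)) t := by
  have h1 := (hasDerivAt_exp_smul_const' (𝕂 := ℝ) N (t₁ - t)).scomp t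
    ((hasDerivAt_const t t₁).sub (hasDerivAt_id t))
  refine (h1.clm_apply (hasDerivAt_const t q)).congr_deriv ?_
  simp

theorem adjoint_exp_smul (M : E →L[ℝ] E) (t : ℝ) :
    adjoint (exp (t • M)) = exp (t • adjoint M) := by
  have h : star (t • M) = t • star M := by rw [star_smul, star_trivial t]
  exact (star_exp (t • M)).trans (congrArg exp h)

theorem norm_exp_smul_adjoint (M : E →L[ℝ] E) (t : ℝ) :
    ‖exp (t • adjoint M)‖ = ‖exp (t • M)‖ := by
  rw [← adjoint_exp_smul, LinearIsometryEquiv.norm_map]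

/-- With `M` and `N` outside, the derivative integrates to the Lyapunov identity for Gramians. The
primed form keeps `M * X + X * N` inside, where a Lyapunov equation kills it. -/
theorem hasDerivAt_exp_mul_mul_exp (M N X : E →L[ℝ] E) (t : ℝ) :
    HasDerivAt (fun t : ℝ => exp (t • M) * X * exp (t • N))
      (M * (exp (t • M) * X * exp (t • N)) + (exp (t • M) * X * exp (t • N)) * N) t := by
  have h := ((hasDerivAt_exp_smul_const' M t).mul_const X).mul (hasDerivAt_exp_smul_const N t)
  refine h.congr_deriv ?_
  simp only [mul_assoc]

theorem hasDerivAt_exp_mul_mul_exp' (M N X : E →L[ℝ] E) (t : ℝ) :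
    HasDerivAt (fun t : ℝ => exp (t • M) * X * exp (t • N))
      (exp (t • M) * (M * X + X * N) * exp (t • N)) t := by
  have h := ((hasDerivAt_exp_smul_const M t).mul_const X).mul (hasDerivAt_exp_smul_const' N t)
  refine h.congr_deriv ?_
  simp only [mul_assoc, mul_add, add_mul]

/-- The homogeneous Lyapunov equation of an exponentially stable operator has only the trivial
solution. -/
theorem eq_zero_of_lyapunov {M X : E →L[ℝ] E}
    (hM : Tendsto (fun t : ℝ => exp (t • M)) atTop (𝓝 0))
    (h : adjoint M * X + X * M = 0) : X = 0 := by
  -- The conjugate of `X` has derivative zero by `h`, so it stays equal to `X` while both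
  -- exponentials tend to zero.
  have hconst : ∀ t : ℝ, exp (t • adjoint M) * X * exp (t • M) = X := by
    intro t
    have := is_const_of_deriv_eq_zero
      (f := fun t : ℝ => exp (t • adjoint M) * X * exp (t • M))
      (fun t => (hasDerivAt_exp_mul_mul_exp' (adjoint M) M X t).differentiableAt)
      (fun t => by rw [(hasDerivAt_exp_mul_mul_exp' (adjoint M) M X t).deriv, h]; simp) t 0
    simpa using this
  have hM' : Tendsto (fun t : ℝ => exp (t • adjoint M)) atTop (𝓝 0) := by
    rw [tendsto_zero_iff_norm_tendsto_zero] at hM ⊢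
    simpa only [norm_exp_smul_adjoint] using hM
  have hlim := (hM'.mul_const X).mul hM
  simp only [hconst] at hlim
  simpa using tendsto_nhds_unique tendsto_const_nhds hlim

/-- The finite-time Gramian `∫₀ᵗ exp (s M) G exp (s M*) ds`. -/
noncomputable def timeGramian (M G : E →L[ℝ] E) (t : ℝ) : E →L[ℝ] E :=
  ∫ s in (0 : ℝ)..t, exp (s • M) * G * exp (s • adjoint M)

theorem continuous_timeGramian_integrand (M G : E →L[ℝ] E) :
    Continuous fun s : ℝ => exp (s • M) * G * exp (s • adjoint M) :=
  ((continuous_exp_smul M).mul continuous_const).mul (continuous_exp_smul (adjoint M))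

@[simp]
theorem timeGramian_zero (M G : E →L[ℝ] E) : timeGramian M G 0 = 0 := by simp [timeGramian]

/-- Integrate the derivative of `exp (s M) G exp (s M*)` over `[0, t]`. The left side is the
derivative of the Gramian, which therefore solves a differential Lyapunov equation. -/
theorem timeGramian_lyapunov (M G : E →L[ℝ] E) (t : ℝ) :
    exp (t • M) * G * exp (t • adjoint M) =
      M * timeGramian M G t + timeGramian M G t * adjoint M + G := by
  have hc := continuous_timeGramian_integrand M G
  have hl : Continuous fun s : ℝ => M * (exp (s • M) * G * exp (s • adjoint M)) :=
    continuous_const.mul hc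
  have hr : Continuous fun s : ℝ => exp (s • M) * G * exp (s • adjoint M) * adjoint M :=
    hc.mul continuous_const
  have h := intervalIntegral.integral_eq_sub_of_hasDerivAt (a := 0) (b := t)
    (fun s _ => hasDerivAt_exp_mul_mul_exp M (adjoint M) G s)
    ((hl.add hr).intervalIntegrable _ _)
  rw [intervalIntegral.integral_add (hl.intervalIntegrable _ _) (hr.intervalIntegrable _ _)] at h
  have h1 : ∫ s in (0 : ℝ)..t, M * (exp (s • M) * G * exp (s • adjoint M)) =
      M * timeGramian M G t :=
    ((ContinuousLinearMap.mul ℝ (E →L[ℝ] E)) M).intervalIntegral_comp_comm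
      (hc.intervalIntegrable _ _)
  have h2 : ∫ s in (0 : ℝ)..t, (exp (s • M) * G * exp (s • adjoint M)) * adjoint M =
      timeGramian M G t * adjoint M :=
    ((ContinuousLinearMap.mul ℝ (E →L[ℝ] E)).flip (adjoint M)).intervalIntegral_comp_comm
      (hc.intervalIntegrable _ _)
  rw [h1, h2] at h
  rw [h]
  simp

theorem hasDerivAt_timeGramian (M G : E →L[ℝ] E) (t : ℝ) :
    HasDerivAt (timeGramian M G)
      (M * timeGramian M G t + timeGramian M G t * adjoint M + G) t := by
  rw [← timeGramian_lyapunov]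
  exact (continuous_timeGramian_integrand M G).integral_hasStrictDerivAt 0 t |>.hasDerivAt

theorem continuous_timeGramian (M G : E →L[ℝ] E) : Continuous (timeGramian M G) :=
  continuous_iff_continuousAt.2 fun t => (hasDerivAt_timeGramian M G t).continuousAt

theorem integrableOn_timeGramian_integrand {M G : E →L[ℝ] E} {c r : ℝ} (hr : r < 0)
    (hM : ∀ t : ℝ, 0 ≤ t → ‖exp (t • M)‖ ≤ c * Real.exp (r * t)) :
    IntegrableOn (fun s : ℝ => exp (s • M) * G * exp (s • adjoint M)) (Ioi 0) := by
  have hc : 0 ≤ c := by simpa using (norm_nonneg _).trans (hM 0 le_rfl)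
  refine ((integrableOn_exp_mul_Ioi hr 0).const_mul (c * ‖G‖ * c)).mono'
    (continuous_timeGramian_integrand M G).aestronglyMeasurable ?_
  filter_upwards [ae_restrict_mem measurableSet_Ioi] with s hs
  have h0 : (0 : ℝ) ≤ s := le_of_lt hs
  have h1 : Real.exp (r * s) ≤ 1 := Real.exp_le_one_iff.2 (by nlinarith)
  have h2 : ‖exp (s • adjoint M)‖ ≤ c * 1 := by
    rw [norm_exp_smul_adjoint]
    exact (hM s h0).trans (by gcongr)
  calc _ ≤ ‖exp (s • M)‖ * ‖G‖ * ‖exp (s • adjoint M)‖ :=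
        (norm_mul_le _ _).trans (mul_le_mul_of_nonneg_right (norm_mul_le _ _) (norm_nonneg _))
    _ ≤ (c * Real.exp (r * s)) * ‖G‖ * (c * 1) := by gcongr; exact hM s h0
    _ = _ := by ring

theorem tendsto_timeGramian {M G : E →L[ℝ] E} {c r : ℝ} (hr : r < 0)
    (hM : ∀ t : ℝ, 0 ≤ t → ‖exp (t • M)‖ ≤ c * Real.exp (r * t)) :
    Tendsto (timeGramian M G) atTop
      (𝓝 (∫ s in Ioi (0 : ℝ), exp (s • M) * G * exp (s • adjoint M))) :=
  intervalIntegral_tendsto_integral_Ioi 0 (integrableOn_timeGramian_integrand hr hM) tendsto_id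

/-- A continuous function on a half-line with a limit at infinity is bounded. -/
theorem exists_bound_of_continuousOn_Ici_of_tendsto {V : Type*} [NormedAddCommGroup V] {f : ℝ → V}
    {v : V} (hf : ContinuousOn f (Ici 0)) (hv : Tendsto f atTop (𝓝 v)) :
    ∃ c : ℝ, 0 < c ∧ ∀ t, 0 ≤ t → ‖f t‖ ≤ c := by
  obtain ⟨T, hT⟩ := eventually_atTop.1 (hv.norm.eventually_le_const (lt_add_one ‖v‖))
  obtain ⟨b, hb⟩ := isCompact_Icc.exists_bound_of_continuousOn (s := Icc (0 : ℝ) T)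
    (hf.mono Icc_subset_Ici_self)
  refine ⟨max b (‖v‖ + 1), lt_max_of_lt_right (by positivity), fun t ht => ?_⟩
  rcases le_total t T with h | h
  · exact (hb t ⟨ht, h⟩).trans (le_max_left _ _)
  · exact (hT t h).trans (le_max_right _ _)

/-- Uniform boundedness of inverses along a continuous curve of invertible elements that converges
to an invertible element. -/
theorem exists_bound_inverse_of_tendsto {𝔸 : Type*} [NormedRing 𝔸] [CompleteSpace 𝔸] {f : ℝ → 𝔸}
    {a : 𝔸} (hf : Continuous f) (hu : ∀ t, 0 ≤ t → IsUnit (f t)) (ha : IsUnit a)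
    (hv : Tendsto f atTop (𝓝 a)) :
    ∃ c : ℝ, 0 < c ∧ ∀ t, 0 ≤ t → ‖Ring.inverse (f t)‖ ≤ c := by
  refine exists_bound_of_continuousOn_Ici_of_tendsto (v := Ring.inverse a)
    (fun t ht => ?_) ?_
  · obtain ⟨w, hw⟩ := hu t ht
    have h := NormedRing.inverse_continuousAt w
    rw [hw] at h
    exact (h.comp hf.continuousAt).continuousWithinAt
  · obtain ⟨w, hw⟩ := ha
    have h := NormedRing.inverse_continuousAt w
    rw [hw] at h
    exact h.tendsto.comp hv

end OperatorExponential

/-! ### Growth of the exponential on generalized eigenspaces -/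

section SpectralBound

/-- `exp (t f) v` for a generalized eigenvector `v`. -/
theorem exp_smul_apply_of_pow_sub_eq_zero {V : Type*} [NormedAddCommGroup V] [NormedSpace ℂ V]
    [CompleteSpace V] (f : V →L[ℂ] V) (z : ℂ) (N : ℕ) (v : V)
    (hv : ((f - z • (1 : V →L[ℂ] V)) ^ N) v = 0) (t : ℂ) :
    exp (t • f) v = Complex.exp (t * z) •
      ∑ j ∈ Finset.range N, ((j.factorial : ℂ)⁻¹ * t ^ j) • ((f - z • (1 : V →L[ℂ] V)) ^ j) v := by
  let : NormedAlgebra ℚ (V →L[ℂ] V) := NormedAlgebra.restrictScalars ℚ ℂ _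
  set g : V →L[ℂ] V := f - z • (1 : V →L[ℂ] V) with hg
  -- A scalar part commutes with the rest, and on `v` the exponential series of `t • g` stops before
  -- `N`.
  have hsplit : t • f = algebraMap ℂ (V →L[ℂ] V) (t * z) + t • g := by
    rw [hg, Algebra.algebraMap_eq_smul_one, smul_sub, smul_smul]; abel
  have hcomm : Commute (algebraMap ℂ (V →L[ℂ] V) (t * z)) (t • g) := Algebra.commutes _ _
  rw [hsplit, exp_add_of_commute hcomm, ← algebraMap_exp_comm, ← Complex.exp_eq_exp_ℂ]
  have hsum := (ContinuousLinearMap.apply ℂ V v).hasSum (exp_series_hasSum_exp' (𝕂 := ℂ) (t • g))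
  have hfin : HasSum (fun j : ℕ => ((j.factorial : ℂ)⁻¹ • (t • g) ^ j) v)
      (∑ j ∈ Finset.range N, ((j.factorial : ℂ)⁻¹ • (t • g) ^ j) v) := by
    refine hasSum_sum_of_ne_finset_zero fun j hj => ?_
    obtain ⟨d, rfl⟩ := Nat.exists_eq_add_of_le (not_lt.1 fun h => hj (Finset.mem_range.2 h))
    have h0 : (g ^ (N + d)) v = 0 := by
      rw [add_comm, pow_add, mul_apply_eq_comp, hv, map_zero]
    rw [smul_pow, smul_apply, smul_apply, h0]
    simp
  have heq : exp (t • g) v = ∑ j ∈ Finset.range N, ((j.factorial : ℂ)⁻¹ • (t • g) ^ j) v :=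
    hsum.unique hfin
  rw [mul_apply_eq_comp, heq, Algebra.algebraMap_eq_smul_one,
    smul_apply, one_apply_eq_self]
  simp only [smul_pow, smul_apply, smul_smul]

/-- `tʲ exp (at)` is bounded by a multiple of `exp (rt)` on `[0, ∞)` if `a < r`. -/
theorem exists_pow_mul_exp_le {a r : ℝ} (har : a < r) (j : ℕ) :
    ∃ c : ℝ, ∀ t : ℝ, 0 ≤ t → t ^ j * Real.exp (a * t) ≤ c * Real.exp (r * t) := by
  have hδ : 0 < r - a := sub_pos.2 har
  -- The constant comes from `y ^ j / j! ≤ exp y` at `y = (r - a) t`.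
  refine ⟨j.factorial / (r - a) ^ j, fun t ht => ?_⟩
  have h := Real.pow_div_factorial_le_exp ((r - a) * t) (by positivity) j
  have h2 : Real.exp (r * t) = Real.exp ((r - a) * t) * Real.exp (a * t) := by
    rw [← Real.exp_add]; ring_nf
  rw [div_le_iff₀ (by positivity), mul_pow] at h
  rw [h2, ← mul_assoc]
  refine mul_le_mul_of_nonneg_right ?_ (Real.exp_nonneg _)
  rw [div_mul_eq_mul_div, le_div_iff₀ (by positivity)]
  linarith

/-- The vectors whose trajectory under `exp (t f)` is `O(exp (rt))` form a submodule. -/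
def expBoundedSubmodule {V : Type*} [NormedAddCommGroup V] [NormedSpace ℂ V]
    (f : V →L[ℂ] V) (r : ℝ) : Submodule ℂ V where
  carrier := {v | ∃ c : ℝ, ∀ t : ℝ, 0 ≤ t → ‖exp ((t : ℂ) • f) v‖ ≤ c * Real.exp (r * t)}
  add_mem' := by
    rintro v w ⟨c, hc⟩ ⟨d, hd⟩
    refine ⟨c + d, fun t ht => ?_⟩
    rw [map_add, add_mul]
    exact (norm_add_le _ _).trans (add_le_add (hc t ht) (hd t ht))
  zero_mem' := ⟨0, fun t _ => by simp⟩
  smul_mem' := by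
    rintro a v ⟨c, hc⟩
    refine ⟨‖a‖ * c, fun t ht => ?_⟩
    rw [map_smul, norm_smul, mul_assoc]
    exact mul_le_mul_of_nonneg_left (hc t ht) (norm_nonneg _)

variable {V : Type*} [NormedAddCommGroup V] [NormedSpace ℂ V] [CompleteSpace V]

/-- The strict gap `z.re < r` absorbs the polynomial factor. -/
theorem mem_expBoundedSubmodule_of_pow_sub_eq_zero {f : V →L[ℂ] V} {z : ℂ} {r : ℝ} (hz : z.re < r)
    {N : ℕ} {v : V} (hv : ((f - z • (1 : V →L[ℂ] V)) ^ N) v = 0) :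
    v ∈ expBoundedSubmodule f r := by
  choose c hc using fun j => exists_pow_mul_exp_le hz j
  refine ⟨∑ j ∈ Finset.range N, c j * ‖((j.factorial : ℂ)⁻¹)‖ *
    ‖((f - z • (1 : V →L[ℂ] V)) ^ j) v‖, fun t ht => ?_⟩
  rw [exp_smul_apply_of_pow_sub_eq_zero f z N v hv, Finset.smul_sum, Finset.sum_mul]
  refine (norm_sum_le _ _).trans (Finset.sum_le_sum fun j _ => ?_)
  rw [norm_smul, norm_smul, norm_mul, norm_pow, Complex.norm_exp, Complex.norm_real,
    Real.norm_of_nonneg ht]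
  have h : ((t : ℂ) * z).re = z.re * t := by simp [mul_comm]
  rw [h]
  calc _ = (t ^ j * Real.exp (z.re * t)) *
        (‖((j.factorial : ℂ)⁻¹)‖ * ‖((f - z • (1 : V →L[ℂ] V)) ^ j) v‖) := by ring
    _ ≤ (c j * Real.exp (r * t)) *
        (‖((j.factorial : ℂ)⁻¹)‖ * ‖((f - z • (1 : V →L[ℂ] V)) ^ j) v‖) :=
      mul_le_mul_of_nonneg_right (hc j t ht) (by positivity)
    _ = _ := by ring

/-- A true eigenvector produces no polynomial factor, so the rate `z.re` itself is reached. -/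
theorem mem_expBoundedSubmodule_of_apply_eq_smul {f : V →L[ℂ] V} {z : ℂ} {r : ℝ} (hz : z.re ≤ r)
    {v : V} (hv : f v = z • v) : v ∈ expBoundedSubmodule f r := by
  refine ⟨‖v‖, fun t ht => ?_⟩
  rw [exp_smul_apply_of_pow_sub_eq_zero f z 1 v (by simp [hv])]
  simp only [Finset.range_one, Finset.sum_singleton, pow_zero, Nat.factorial_zero, Nat.cast_one,
    inv_one, one_mul, one_smul, one_apply_eq_self, norm_smul, Complex.norm_exp]
  rw [mul_comm]
  refine mul_le_mul_of_nonneg_left (Real.exp_le_exp.2 ?_) (norm_nonneg _)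
  simp only [Complex.mul_re, Complex.ofReal_re, Complex.ofReal_im, zero_mul, sub_zero]
  nlinarith

/-- If the real parts of the eigenvalues are at most `r`, and those with real part `r` are
semisimple, then every trajectory is `O(exp (rt))`. -/
theorem expBoundedSubmodule_eq_top [FiniteDimensional ℂ V] {f : V →L[ℂ] V} {r : ℝ}
    (hle : ∀ z, Module.End.HasEigenvalue (f : V →ₗ[ℂ] V) z → z.re ≤ r)
    (hss : ∀ z, Module.End.HasEigenvalue (f : V →ₗ[ℂ] V) z → z.re = r →
      Module.End.maxGenEigenspace (f : V →ₗ[ℂ] V) z = Module.End.eigenspace (f : V →ₗ[ℂ] V) z) :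
    expBoundedSubmodule f r = ⊤ := by
  -- Over `ℂ` the generalized eigenspaces span, so each may be treated alone.
  rw [eq_top_iff, ← Module.End.iSup_maxGenEigenspace_eq_top (f : V →ₗ[ℂ] V)]
  refine iSup_le fun z v hv => ?_
  by_cases hz : Module.End.HasEigenvalue (f : V →ₗ[ℂ] V) z
  · rcases (hle z hz).lt_or_eq with hlt | heq
    · obtain ⟨N, hN⟩ := (Module.End.mem_maxGenEigenspace _ _ _).1 hv
      refine mem_expBoundedSubmodule_of_pow_sub_eq_zero hlt (N := N) ?_
      have h : ∀ N : ℕ, (((f - z • (1 : V →L[ℂ] V)) ^ N : V →L[ℂ] V) : V →ₗ[ℂ] V) =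
          ((f : V →ₗ[ℂ] V) - z • 1) ^ N := by
        intro N; induction N with
        | zero => rfl
        | succ N ih => rw [pow_succ, pow_succ, ← ih]; rfl
      rw [← h] at hN
      exact hN
    · rw [hss z hz heq, Module.End.mem_eigenspace_iff] at hv
      exact mem_expBoundedSubmodule_of_apply_eq_smul heq.le hv
  · have h1 : Module.End.maxGenEigenspace (f : V →ₗ[ℂ] V) z = ⊥ := by
      by_contra h
      exact hz (Module.End.HasUnifEigenvalue.lt zero_lt_one h)
    rw [h1, Submodule.mem_bot] at hv
    rw [hv]; exact zero_mem _

end SpectralBound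

/-! ### Decay of real matrix exponentials via complexification -/

section RealMatrix

variable {n : ℕ}

theorem spectrum_map_ofReal_finite (M : Matrix (Fin n) (Fin n) ℝ) :
    (spectrum ℂ (M.map (fun a : ℝ => (a : ℂ)))).Finite := by
  rw [← Matrix.spectrum_toLin']
  exact Module.End.finite_spectrum _

theorem re_le_spectralAbscissa {M : Matrix (Fin n) (Fin n) ℝ} {z : ℂ}
    (hz : z ∈ spectrum ℂ (M.map (fun a : ℝ => (a : ℂ)))) : z.re ≤ spectralAbscissa M :=
  le_csSup ((spectrum_map_ofReal_finite M).image _).bddAbove (mem_image_of_mem _ hz)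

/-- The supremum is attained, since the spectrum is finite and, as `n > 0`, nonempty. For `n = 0`
the value would be `sSup ∅ = 0`. -/
theorem spectralAbscissa_neg (hn : 0 < n) {M : Matrix (Fin n) (Fin n) ℝ} (hM : IsStableMatrix M) :
    spectralAbscissa M < 0 := by
  have : Nonempty (Fin n) := ⟨⟨0, hn⟩⟩
  have hne : (spectrum ℂ (M.map (fun a : ℝ => (a : ℂ)))).Nonempty :=
    spectrum.nonempty_of_isAlgClosed_of_finiteDimensional ℂ _
  obtain ⟨z, hz, h⟩ := (hne.image Complex.re).csSup_mem ((spectrum_map_ofReal_finite M).image _)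
  rw [spectralAbscissa, ← h]
  exact hM z hz

section

attribute [local instance] Matrix.linftyOpNormedRing Matrix.linftyOpNormedAlgebra

/-- The local matrix norm only serves `map_exp`; the exponential itself does not depend on it. -/
theorem toEuclideanCLM_exp (M : Matrix (Fin n) (Fin n) ℝ) :
    Matrix.toEuclideanCLM (𝕜 := ℝ) (exp M) = exp (Matrix.toEuclideanCLM (𝕜 := ℝ) M) := by
  let : NormedAlgebra ℚ (Matrix (Fin n) (Fin n) ℝ) := NormedAlgebra.restrictScalars ℚ ℝ _
  exact map_exp (Matrix.toEuclideanCLM (n := Fin n) (𝕜 := ℝ))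
    (LinearMap.continuous_of_finiteDimensional
    (Matrix.toEuclideanCLM (n := Fin n) (𝕜 := ℝ)).toAlgEquiv.toLinearMap) M

/-- The complexification of a real matrix, as a ring homomorphism into the continuous linear
endomorphisms of `ℂⁿ`. -/
noncomputable def complexCLM (n : ℕ) : Matrix (Fin n) (Fin n) ℝ →+* ((Fin n → ℂ) →L[ℂ] (Fin n → ℂ)) :=
  ((Matrix.toLinAlgEquiv'.trans (Module.End.toContinuousLinearMap (𝕜 := ℂ) (Fin n → ℂ)) :
    Matrix (Fin n) (Fin n) ℂ ≃ₐ[ℂ] _) : Matrix (Fin n) (Fin n) ℂ →+* _).comp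
    (Complex.ofRealHom.mapMatrix)

theorem coe_complexCLM (M : Matrix (Fin n) (Fin n) ℝ) :
    (complexCLM n M : (Fin n → ℂ) →ₗ[ℂ] (Fin n → ℂ)) =
      Matrix.toLin' (M.map (fun a : ℝ => (a : ℂ))) := rfl

theorem complexCLM_apply_ofReal (M : Matrix (Fin n) (Fin n) ℝ) (v : Fin n → ℝ) :
    complexCLM n M (fun i => (v i : ℂ)) = fun i => ((M.mulVec v i : ℝ) : ℂ) := by
  ext i
  change (Matrix.toLin' (M.map (fun a : ℝ => (a : ℂ)))) (fun i => (v i : ℂ)) i = _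
  simp [Matrix.mulVec, dotProduct]

theorem complexCLM_smul (t : ℝ) (M : Matrix (Fin n) (Fin n) ℝ) :
    complexCLM n (t • M) = (t : ℂ) • complexCLM n M := by
  apply ContinuousLinearMap.coe_injective
  rw [ContinuousLinearMap.toLinearMap_smul, coe_complexCLM, coe_complexCLM, ← map_smul]
  congr 1
  ext i j
  simp

theorem complexCLM_exp (M : Matrix (Fin n) (Fin n) ℝ) :
    complexCLM n (exp M) = exp (complexCLM n M) := by
  let : NormedAlgebra ℚ (Matrix (Fin n) (Fin n) ℝ) := NormedAlgebra.restrictScalars ℚ ℝ _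
  let : NormedAlgebra ℚ ((Fin n → ℂ) →L[ℂ] (Fin n → ℂ)) := NormedAlgebra.restrictScalars ℚ ℂ _
  refine map_exp (complexCLM n) ?_ M
  exact (LinearMap.continuous_of_finiteDimensional
    (Matrix.toLinAlgEquiv'.trans (Module.End.toContinuousLinearMap (𝕜 := ℂ) (Fin n → ℂ)) :
      Matrix (Fin n) (Fin n) ℂ ≃ₐ[ℂ] _).toLinearMap).comp
    (continuous_id.matrix_map Complex.continuous_ofReal)

end

/-- Exponential bound for `exp (t M)` at a rate `r` that dominates the spectral abscissa. -/
theorem exists_norm_exp_smul_le {M : Matrix (Fin n) (Fin n) ℝ} {r : ℝ}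
    (hr : spectralAbscissa M < r ∨ spectralAbscissa M = r ∧ HasSemisimpleAbscissa M) :
    ∃ c : ℝ, 0 < c ∧ ∀ t : ℝ, 0 ≤ t →
      ‖exp (t • Matrix.toEuclideanCLM (𝕜 := ℝ) M)‖ ≤ c * Real.exp (r * t) := by
  have hspec : ∀ z, Module.End.HasEigenvalue
      (complexCLM n M : (Fin n → ℂ) →ₗ[ℂ] (Fin n → ℂ)) z → z.re ≤ spectralAbscissa M := by
    intro z hz
    rw [coe_complexCLM, Module.End.hasEigenvalue_iff_mem_spectrum, Matrix.spectrum_toLin'] at hz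
    exact re_le_spectralAbscissa hz
  have htop : expBoundedSubmodule (complexCLM n M) r = ⊤ := by
    refine expBoundedSubmodule_eq_top (fun z hz => (hspec z hz).trans ?_) fun z hz hzr => ?_
    · rcases hr with h | h
      exacts [h.le, h.1.le]
    · rcases hr with h | ⟨h, hss⟩
      · exact absurd (hspec z hz) (by rw [hzr]; exact not_le.2 h)
      · exact hss z (hzr.trans h.symm)
  set Φ := (EuclideanSpace.equiv (Fin n) ℝ).symm with hΦ
  -- Real vectors embed isometrically into `ℂⁿ` for the sup norm; `Φ` passes to the Euclidean norm.
  have hpt : ∀ v : EuclideanSpace ℝ (Fin n), ∃ c : ℝ, ∀ t : ℝ, 0 ≤ t →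
      ‖exp (t • Matrix.toEuclideanCLM (𝕜 := ℝ) M) v‖ ≤ c * Real.exp (r * t) := by
    intro v
    obtain ⟨c, hc⟩ : (fun i => (v i : ℂ)) ∈ expBoundedSubmodule (complexCLM n M) r :=
      htop ▸ Submodule.mem_top
    refine ⟨‖(Φ : (Fin n → ℝ) →L[ℝ] EuclideanSpace ℝ (Fin n))‖ * c, fun t ht => ?_⟩
    have h := hc t ht
    rw [← complexCLM_smul, ← complexCLM_exp, complexCLM_apply_ofReal] at h
    have h2 : ‖(exp (t • M)).mulVec v‖ ≤ c * Real.exp (r * t) := by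
      refine le_trans (le_of_eq ?_) h
      simp [Pi.norm_def]
    rw [← map_smul, ← toEuclideanCLM_exp, mul_assoc]
    exact ((Φ : (Fin n → ℝ) →L[ℝ] EuclideanSpace ℝ (Fin n)).le_opNorm
      ((exp (t • M)).mulVec v)).trans (mul_le_mul_of_nonneg_left h2 (norm_nonneg _))
  -- The pointwise constants depend on `v`; uniform boundedness of `exp (-r t) exp (t M)` over `t ≥
  -- 0` yields one for the operator norm.
  obtain ⟨c, hc⟩ := banach_steinhaus
    (g := fun t : {t : ℝ // 0 ≤ t} =>
      Real.exp (-(r * t)) • exp ((t : ℝ) • Matrix.toEuclideanCLM (𝕜 := ℝ) M)) (fun v => by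
      obtain ⟨c, hc⟩ := hpt v
      refine ⟨c, fun t => ?_⟩
      rw [smul_apply, norm_smul, Real.norm_of_nonneg (Real.exp_nonneg _),
        Real.exp_neg, inv_mul_le_iff₀ (Real.exp_pos _), mul_comm]
      exact hc t t.2)
  refine ⟨max c 1, lt_max_of_lt_right one_pos, fun t ht => ?_⟩
  have h := hc ⟨t, ht⟩
  simp only at h
  rw [norm_smul, Real.norm_of_nonneg (Real.exp_nonneg _), Real.exp_neg,
    inv_mul_le_iff₀ (Real.exp_pos _), mul_comm] at h
  exact h.trans (mul_le_mul_of_nonneg_right (le_max_left _ _) (Real.exp_nonneg _))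

end RealMatrix

/-! ### Rectangular matrices as operators -/

section MatrixOperator

variable {a b c : ℕ}

/-- The operator between Euclidean spaces given by a rectangular real matrix. -/
noncomputable def euclideanOp (M : Matrix (Fin a) (Fin b) ℝ) :
    EuclideanSpace ℝ (Fin b) →L[ℝ] EuclideanSpace ℝ (Fin a) :=
  LinearMap.toContinuousLinearMap (Matrix.toEuclideanLin M)

theorem euclideanOp_apply (M : Matrix (Fin a) (Fin b) ℝ) (v : EuclideanSpace ℝ (Fin b)) :
    euclideanOp M v = Matrix.toEuclideanLin M v := rfl

theorem euclideanOp_mul (M : Matrix (Fin a) (Fin b) ℝ) (N : Matrix (Fin b) (Fin c) ℝ) :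
    euclideanOp (M * N) = (euclideanOp M).comp (euclideanOp N) := by
  ext1 v
  rw [ContinuousLinearMap.comp_apply, euclideanOp_apply, euclideanOp_apply, euclideanOp_apply]
  simp [Matrix.toEuclideanLin]

theorem adjoint_euclideanOp (M : Matrix (Fin a) (Fin b) ℝ) :
    adjoint (euclideanOp M) = euclideanOp M.transpose := by
  have h := Matrix.toEuclideanLin_conjTranspose_eq_adjoint M
  rw [Matrix.conjTranspose_eq_transpose_of_trivial] at h
  rw [euclideanOp, euclideanOp, h]
  exact (LinearMap.adjoint_toContinuousLinearMap _).symm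

end MatrixOperator

/-! ### Extremals: optimality and uniqueness by convexity -/

namespace AffineLQR

variable {n m k l : ℕ} (D : AffineLQR n m k l)

/-- A pair of a state and a costate that satisfies the Hamiltonian boundary value problem on
`[0, t₁]`; the corresponding control is `-B* p`. -/
structure IsExtremal (t₁ : ℝ) (x p : ℝ → EuclideanSpace ℝ (Fin n)) : Prop where
  hasDerivAt_state : ∀ t, HasDerivAt x
    (euclideanOp D.A (x t) - euclideanOp D.B (adjoint (euclideanOp D.B) (p t))) t
  initial : x 0 = D.x₀
  hasDerivAt_costate : ∀ t, HasDerivAt p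
    (-adjoint (euclideanOp D.A) (p t) -
      adjoint (euclideanOp D.C) (euclideanOp D.C (x t) - D.yc)) t
  terminal : p t₁ = adjoint (euclideanOp D.F) (euclideanOp D.F (x t₁) - D.ye)

variable {D} {t₁ : ℝ} {x p : ℝ → EuclideanSpace ℝ (Fin n)}

namespace IsExtremal

theorem continuous_state (h : D.IsExtremal t₁ x p) : Continuous x :=
  continuous_iff_continuousAt.2 fun t => (h.hasDerivAt_state t).continuousAt

theorem continuous_costate (h : D.IsExtremal t₁ x p) : Continuous p :=
  continuous_iff_continuousAt.2 fun t => (h.hasDerivAt_costate t).continuousAt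

theorem continuous_control (h : D.IsExtremal t₁ x p) :
    Continuous fun t => -adjoint (euclideanOp D.B) (p t) :=
  ((adjoint (euclideanOp D.B)).continuous.comp h.continuous_costate).neg

theorem isAdmissible (h : D.IsExtremal t₁ x p) :
    D.IsAdmissible t₁ x (fun t => -adjoint (euclideanOp D.B) (p t)) where
  memLp_control := by
    obtain ⟨M, hM⟩ := isCompact_Icc.exists_bound_of_continuousOn (s := Icc (0 : ℝ) t₁)
      h.continuous_control.continuousOn
    refine MemLp.of_bound h.continuous_control.aestronglyMeasurable M ?_
    filter_upwards [ae_restrict_mem measurableSet_Icc] with t ht using hM t ht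
  continuousOn_state := h.continuous_state.continuousOn
  state_eq := by
    intro t _
    have hcont : Continuous fun s => euclideanOp D.A (x s) +
        euclideanOp D.B (-adjoint (euclideanOp D.B) (p s)) :=
      ((euclideanOp D.A).continuous.comp h.continuous_state).add
        ((euclideanOp D.B).continuous.comp h.continuous_control)
    have hint := intervalIntegral.integral_eq_sub_of_hasDerivAt (a := 0) (b := t)
      (f' := fun s => euclideanOp D.A (x s) + euclideanOp D.B (-adjoint (euclideanOp D.B) (p s)))
      (fun s _ => (h.hasDerivAt_state s).congr_deriv (by rw [map_neg, sub_eq_add_neg]))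
      (hcont.intervalIntegrable _ _)
    simp only [← euclideanOp_apply]
    rw [hint, h.initial]
    abel

end IsExtremal

theorem IsAdmissible.intervalIntegrable_control {x' : ℝ → EuclideanSpace ℝ (Fin n)}
    {u' : ℝ → EuclideanSpace ℝ (Fin m)} (ht : 0 ≤ t₁) (h : D.IsAdmissible t₁ x' u') :
    IntervalIntegrable u' volume 0 t₁ := by
  rw [intervalIntegrable_iff_integrableOn_Icc_of_le ht]
  exact h.memLp_control.integrable (by norm_num)

theorem IsAdmissible.intervalIntegrable_state {x' : ℝ → EuclideanSpace ℝ (Fin n)}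
    {u' : ℝ → EuclideanSpace ℝ (Fin m)} (ht : 0 ≤ t₁) (h : D.IsAdmissible t₁ x' u') :
    IntervalIntegrable x' volume 0 t₁ :=
  h.continuousOn_state.intervalIntegrable_of_Icc ht

theorem intervalIntegrable_clm_comp {E F : Type*} [NormedAddCommGroup E] [NormedSpace ℝ E]
    [NormedAddCommGroup F] [NormedSpace ℝ F] (L : E →L[ℝ] F) {f : ℝ → E} {c d : ℝ}
    (hf : IntervalIntegrable f volume c d) : IntervalIntegrable (fun s => L (f s)) volume c d :=
  ⟨L.integrable_comp hf.1, L.integrable_comp hf.2⟩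

/-- The difference of two admissible states is the primitive of the difference of the
right-hand sides. -/
theorem IsAdmissible.sub_eq_integral {x' y : ℝ → EuclideanSpace ℝ (Fin n)}
    {u' v : ℝ → EuclideanSpace ℝ (Fin m)}
    (h : D.IsAdmissible t₁ x' u') (h' : D.IsAdmissible t₁ y v) {t : ℝ} (ht : t ∈ Icc 0 t₁) :
    x' t - y t = ∫ s in (0 : ℝ)..t,
      (euclideanOp D.A (x' s - y s) + euclideanOp D.B (u' s - v s)) := by
  have hsub : uIcc 0 t ⊆ uIcc 0 t₁ := by
    rw [uIcc_of_le ht.1, uIcc_of_le (ht.1.trans ht.2)]; exact Icc_subset_Icc_right ht.2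
  have h0 : 0 ≤ t₁ := ht.1.trans ht.2
  have hi : ∀ {x' : ℝ → EuclideanSpace ℝ (Fin n)} {u' : ℝ → EuclideanSpace ℝ (Fin m)},
      D.IsAdmissible t₁ x' u' →
      IntervalIntegrable (fun s => euclideanOp D.A (x' s) + euclideanOp D.B (u' s)) volume 0 t := by
    intro x' u' h
    exact ((intervalIntegrable_clm_comp _ (h.intervalIntegrable_state h0)).add
      (intervalIntegrable_clm_comp _ (h.intervalIntegrable_control h0))).mono_set hsub
  rw [h.state_eq t ht, h'.state_eq t ht, add_sub_add_left_eq_sub]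
  simp only [← euclideanOp_apply]
  rw [← intervalIntegral.integral_sub (hi h) (hi h')]
  refine intervalIntegral.integral_congr fun s _ => ?_
  simp only [map_sub]
  abel

/-- Completion of the square: the cost of an admissible pair exceeds the cost of an extremal by
the quadratic cost of the difference. -/
theorem IsExtremal.cost_eq (ht : 0 ≤ t₁) (h : D.IsExtremal t₁ x p)
    {x' : ℝ → EuclideanSpace ℝ (Fin n)} {u' : ℝ → EuclideanSpace ℝ (Fin m)}
    (h' : D.IsAdmissible t₁ x' u') :
    IntervalIntegrable (fun s => ‖u' s + adjoint (euclideanOp D.B) (p s)‖ ^ 2) volume 0 t₁ ∧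
    D.cost t₁ x' u' = D.cost t₁ x (fun t => -adjoint (euclideanOp D.B) (p t)) +
      (1 / 2 * (∫ s in (0 : ℝ)..t₁, (‖euclideanOp D.C (x' s - x s)‖ ^ 2 +
        ‖u' s + adjoint (euclideanOp D.B) (p s)‖ ^ 2)) +
      1 / 2 * ‖euclideanOp D.F (x' t₁ - x t₁)‖ ^ 2) := by
  set A := euclideanOp D.A
  set B := euclideanOp D.B with hB
  set C := euclideanOp D.C with hC
  set F := euclideanOp D.F with hF
  set u : ℝ → EuclideanSpace ℝ (Fin m) := fun t => -adjoint B (p t) with hu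
  have hadm : D.IsAdmissible t₁ x u := h.isAdmissible
  have huc : Continuous u := h.continuous_control
  have hsum : ∀ s, u' s + adjoint B (p s) = u' s - u s := fun s => by simp [hu]
  simp only [hsum]
  have hdx : ContinuousOn (fun s => x' s - x s) (Icc 0 t₁) :=
    h'.continuousOn_state.sub h.continuous_state.continuousOn
  have hdu : IntervalIntegrable (fun s => u' s - u s) volume 0 t₁ :=
    (h'.intervalIntegrable_control ht).sub (huc.intervalIntegrable _ _)
  have hdu2 : IntervalIntegrable (fun s => ‖u' s - u s‖ ^ 2) volume 0 t₁ := by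
    rw [intervalIntegrable_iff_integrableOn_Icc_of_le ht]
    exact (h'.memLp_control.sub hadm.memLp_control).norm.integrable_sq
  have hCdx2 : IntervalIntegrable (fun s => ‖C (x' s - x s)‖ ^ 2) volume 0 t₁ :=
    ContinuousOn.intervalIntegrable_of_Icc ht
      ((C.continuous.comp_continuousOn hdx).norm.pow 2)
  have hcross1 : IntervalIntegrable (fun s => ⟪C (x s) - D.yc, C (x' s - x s)⟫_ℝ) volume 0 t₁ :=
    ContinuousOn.intervalIntegrable_of_Icc ht
      (((C.continuous.comp h.continuous_state).sub continuous_const).continuousOn.inner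
        (C.continuous.comp_continuousOn hdx))
  have hcross2 : IntervalIntegrable (fun s => ⟪u s, u' s - u s⟫_ℝ) volume 0 t₁ := by
    have h1 : IntervalIntegrable (fun s => ‖u' s‖ ^ 2) volume 0 t₁ := by
      rw [intervalIntegrable_iff_integrableOn_Icc_of_le ht]
      exact h'.memLp_control.norm.integrable_sq
    have h2 : IntervalIntegrable (fun s => ‖u s‖ ^ 2) volume 0 t₁ :=
      (huc.norm.pow 2).intervalIntegrable _ _
    -- Polarization reduces integrability of the product to that of squares.
    have h3 : (fun s => ⟪u s, u' s - u s⟫_ℝ) =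
        fun s => (‖u' s‖ ^ 2 - ‖u s‖ ^ 2 - ‖u' s - u s‖ ^ 2) / 2 := by
      ext s
      have := norm_add_sq_real (u s) (u' s - u s)
      rw [add_sub_cancel] at this
      linarith
    rw [h3]
    exact ((h1.sub h2).sub hdu2).div_const 2
  refine ⟨hdu2, ?_⟩
  have hparts := integral_inner_primitive_add (g := fun s => A (x' s - x s) + B (u' s - u s))
    ht h.hasDerivAt_costate
    (((adjoint A).continuous.comp h.continuous_costate).neg.sub ((adjoint C).continuous.comp
      ((C.continuous.comp h.continuous_state).sub continuous_const)))
    ((intervalIntegrable_clm_comp A (hdx.intervalIntegrable_of_Icc ht)).add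
      (intervalIntegrable_clm_comp B hdu))
  rw [← h'.sub_eq_integral hadm (right_mem_Icc.2 ht), h.terminal,
    ContinuousLinearMap.adjoint_inner_left] at hparts
  -- The first variation vanishes: the `A` terms cancel in the pairing with the costate, and the
  -- terminal condition turns the boundary value into the linear part of the terminal cost.
  have hcross : ∫ s in (0 : ℝ)..t₁, (⟪C (x s) - D.yc, C (x' s - x s)⟫_ℝ +
      ⟪u s, u' s - u s⟫_ℝ) = -⟪F (x t₁) - D.ye, F (x' t₁ - x t₁)⟫_ℝ := by
    rw [← hparts, ← intervalIntegral.integral_neg]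
    refine intervalIntegral.integral_congr fun s hs => ?_
    rw [uIcc_of_le ht] at hs
    rw [← h'.sub_eq_integral hadm hs]
    simp only [inner_sub_left, inner_neg_left, inner_add_right,
      ContinuousLinearMap.adjoint_inner_left, hu]
    ring
  have hrun : ∀ s, ‖C (x' s) - D.yc‖ ^ 2 + ‖u' s‖ ^ 2 =
      (‖C (x s) - D.yc‖ ^ 2 + ‖u s‖ ^ 2) +
      ((‖C (x' s - x s)‖ ^ 2 + ‖u' s - u s‖ ^ 2) +
      2 * (⟪C (x s) - D.yc, C (x' s - x s)⟫_ℝ + ⟪u s, u' s - u s⟫_ℝ)) := by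
    intro s
    have h1 := norm_add_sq_real (C (x s) - D.yc) (C (x' s - x s))
    have h2 := norm_add_sq_real (u s) (u' s - u s)
    rw [show C (x s) - D.yc + C (x' s - x s) = C (x' s) - D.yc by rw [map_sub]; abel] at h1
    rw [add_sub_cancel] at h2
    linarith
  have hterm := norm_add_sq_real (F (x t₁) - D.ye) (F (x' t₁ - x t₁))
  rw [show F (x t₁) - D.ye + F (x' t₁ - x t₁) = F (x' t₁) - D.ye by rw [map_sub]; abel] at hterm
  have hbase : IntervalIntegrable (fun s => ‖C (x s) - D.yc‖ ^ 2 + ‖u s‖ ^ 2) volume 0 t₁ :=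
    ((((C.continuous.comp h.continuous_state).sub continuous_const).norm.pow 2).add
      (huc.norm.pow 2)).intervalIntegrable _ _
  simp only [cost, ← euclideanOp_apply, ← hC, ← hF]
  simp only [hrun]
  rw [intervalIntegral.integral_add hbase
      ((hCdx2.add hdu2).add ((hcross1.add hcross2).const_mul 2)),
    intervalIntegral.integral_add (hCdx2.add hdu2) ((hcross1.add hcross2).const_mul 2),
    intervalIntegral.integral_const_mul, hcross, hterm]
  ring

theorem IsExtremal.isOptimal (ht : 0 ≤ t₁) (h : D.IsExtremal t₁ x p) :
    D.IsOptimal t₁ x (fun t => -adjoint (euclideanOp D.B) (p t)) := by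
  refine ⟨h.isAdmissible, fun x' u' h' => ?_⟩
  rw [(h.cost_eq ht h').2]
  have : 0 ≤ ∫ s in (0 : ℝ)..t₁, (‖euclideanOp D.C (x' s - x s)‖ ^ 2 +
      ‖u' s + adjoint (euclideanOp D.B) (p s)‖ ^ 2) :=
    intervalIntegral.integral_nonneg ht fun s _ => by positivity
  have h2 : 0 ≤ ‖euclideanOp D.F (x' t₁ - x t₁)‖ ^ 2 := by positivity
  linarith

/-- Admissible pairs with almost everywhere equal controls have equal states. -/
theorem IsAdmissible.eqOn_state {x' y : ℝ → EuclideanSpace ℝ (Fin n)}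
    {u' v : ℝ → EuclideanSpace ℝ (Fin m)}
    (h : D.IsAdmissible t₁ x' u') (h' : D.IsAdmissible t₁ y v)
    (huv : u' =ᵐ[volume.restrict (Icc 0 t₁)] v) : EqOn x' y (Icc 0 t₁) := by
  intro t ht
  set A := euclideanOp D.A with hA
  set w := x' t - y t with hw
  have hdx : ∀ s ∈ Icc 0 t, x' s - y s = ∫ τ in (0 : ℝ)..s, A (x' τ - y τ) := by
    intro s hs
    have hs' : s ∈ Icc 0 t₁ := ⟨hs.1, hs.2.trans ht.2⟩
    rw [h.sub_eq_integral h' hs']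
    refine intervalIntegral.integral_congr_ae ?_
    have huv' := (ae_restrict_iff' measurableSet_Icc).1 huv
    filter_upwards [huv'] with τ hτ hτs
    rw [uIoc_of_le hs.1] at hτs
    rw [hτ ⟨hτs.1.le, hτs.2.trans hs'.2⟩]
    simp [hA]
  have hcont : ContinuousOn (fun s => A (x' s - y s)) (Icc 0 t) :=
    A.continuous.comp_continuousOn ((h.continuousOn_state.sub h'.continuousOn_state).mono
      (Icc_subset_Icc_right ht.2))
  -- Duality instead of Gronwall: the pairing of `x' - y` with this backward adjoint solution is
  -- constant. It is `0` at time `0` and `‖w‖²` at time `t`.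
  have hp := hasDerivAt_exp_sub_smul_apply (adjoint A) t w
  have hpc : Continuous fun s : ℝ => exp ((t - s) • adjoint A) w :=
    continuous_iff_continuousAt.2 fun s => (hp s).continuousAt
  have hparts := integral_inner_primitive_add ht.1 hp
    ((adjoint A).continuous.comp hpc).neg (hcont.intervalIntegrable_of_Icc ht.1)
  rw [← hdx t (right_mem_Icc.2 ht.1)] at hparts
  have hzero : ∫ s in (0 : ℝ)..t, (⟪-adjoint A (exp ((t - s) • adjoint A) w),
      ∫ τ in (0 : ℝ)..s, A (x' τ - y τ)⟫_ℝ +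
      ⟪exp ((t - s) • adjoint A) w, A (x' s - y s)⟫_ℝ) = 0 := by
    rw [intervalIntegral.integral_congr (g := fun _ => (0 : ℝ)), intervalIntegral.integral_zero]
    intro s hs
    rw [uIcc_of_le ht.1] at hs
    simp only
    rw [← hdx s hs, inner_neg_left, ContinuousLinearMap.adjoint_inner_left]
    ring
  rw [hzero] at hparts
  simp only [sub_self, zero_smul, NormedSpace.exp_zero, one_apply_eq_self] at hparts
  exact sub_eq_zero.1 (inner_self_eq_zero.1 hparts.symm)

/-- Uniqueness of optimal pairs in the presence of an extremal. -/
theorem IsExtremal.unique (ht : 0 ≤ t₁) (h : D.IsExtremal t₁ x p)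
    {x' : ℝ → EuclideanSpace ℝ (Fin n)} {u' : ℝ → EuclideanSpace ℝ (Fin m)}
    (h' : D.IsOptimal t₁ x' u') :
    EqOn x' x (Icc 0 t₁) ∧
      u' =ᵐ[volume.restrict (Icc 0 t₁)] fun t => -adjoint (euclideanOp D.B) (p t) := by
  obtain ⟨hint, hcost⟩ := h.cost_eq ht h'.1
  have hle := h'.2 _ _ h.isAdmissible
  rw [hcost] at hle
  have hCint : IntervalIntegrable (fun s => ‖euclideanOp D.C (x' s - x s)‖ ^ 2) volume 0 t₁ :=
    ContinuousOn.intervalIntegrable_of_Icc ht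
      (((euclideanOp D.C).continuous.comp_continuousOn
        (h'.1.continuousOn_state.sub h.continuous_state.continuousOn)).norm.pow 2)
  rw [intervalIntegral.integral_add hCint hint] at hle
  have h1 : 0 ≤ ∫ s in (0 : ℝ)..t₁, ‖euclideanOp D.C (x' s - x s)‖ ^ 2 :=
    intervalIntegral.integral_nonneg ht fun s _ => by positivity
  have h2 : 0 ≤ ∫ s in (0 : ℝ)..t₁, ‖u' s + adjoint (euclideanOp D.B) (p s)‖ ^ 2 :=
    intervalIntegral.integral_nonneg ht fun s _ => by positivity
  have h3 : 0 ≤ ‖euclideanOp D.F (x' t₁ - x t₁)‖ ^ 2 := by positivity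
  -- Optimality makes the nonnegative excess vanish. The control term alone suffices, since the
  -- control determines the state.
  have h4 : ∫ s in (0 : ℝ)..t₁, ‖u' s + adjoint (euclideanOp D.B) (p s)‖ ^ 2 = 0 := by linarith
  have hae : u' =ᵐ[volume.restrict (Icc 0 t₁)] fun t => -adjoint (euclideanOp D.B) (p t) := by
    rw [intervalIntegral.integral_of_le ht, ← integral_Icc_eq_integral_Ioc,
      integral_eq_zero_iff_of_nonneg (fun s => by positivity)
        ((intervalIntegrable_iff_integrableOn_Icc_of_le ht).1 hint)] at h4
    filter_upwards [h4] with s hs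
    exact eq_neg_of_add_eq_zero_left (by simpa using hs)
  exact ⟨h'.1.eqOn_state h.isAdmissible hae, hae⟩

end AffineLQR

/-! ### Consequences of exponential stability -/

section Decay

variable {E : Type*} [NormedAddCommGroup E] [InnerProductSpace ℝ E]

theorem exp_zero_smul (M : E →L[ℝ] E) : exp ((0 : ℝ) • M) = 1 := by
  rw [zero_smul, exp_zero]

theorem tendsto_exp_smul_zero {M : E →L[ℝ] E} {c r : ℝ} (hr : r < 0)
    (hM : ∀ t : ℝ, 0 ≤ t → ‖exp (t • M)‖ ≤ c * Real.exp (r * t)) :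
    Tendsto (fun t : ℝ => exp (t • M)) atTop (𝓝 0) := by
  refine squeeze_zero_norm' (eventually_atTop.2 ⟨0, fun t ht => hM t ht⟩) ?_
  have h : Tendsto (fun t : ℝ => Real.exp (r * t)) atTop (𝓝 0) :=
    Real.tendsto_exp_atBot.comp (tendsto_id.const_mul_atTop_of_neg hr)
  simpa using h.const_mul c

variable [CompleteSpace E]

/-- A kernel vector is fixed by a semigroup that tends to zero. -/
theorem eq_zero_of_apply_eq_zero_of_tendsto {M : E →L[ℝ] E}
    (hM : Tendsto (fun t : ℝ => exp (t • M)) atTop (𝓝 0)) {v : E} (hv : M v = 0) : v = 0 := by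
  have hd : ∀ t : ℝ, HasDerivAt (fun t : ℝ => exp (t • M) v) 0 t := fun t => by
    have h := (hasDerivAt_exp_smul_const (𝕂 := ℝ) M t).clm_apply (hasDerivAt_const t v)
    refine h.congr_deriv ?_
    simp [hv]
  have hconst : ∀ t : ℝ, exp (t • M) v = v := fun t => by
    simpa using is_const_of_deriv_eq_zero (fun t => (hd t).differentiableAt)
      (fun t => (hd t).deriv) t 0
  have hlim : Tendsto (fun t : ℝ => exp (t • M) v) atTop (𝓝 0) := by
    have h := ((ContinuousLinearMap.apply ℝ E v).continuous.tendsto 0).comp hM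
    rwa [map_zero] at h
  simp only [hconst] at hlim
  exact tendsto_nhds_unique tendsto_const_nhds hlim

theorem surjective_of_tendsto_exp_smul_zero [FiniteDimensional ℝ E] {M : E →L[ℝ] E}
    (hM : Tendsto (fun t : ℝ => exp (t • M)) atTop (𝓝 0)) : Function.Surjective M := by
  refine LinearMap.surjective_of_injective (f := (M : E →ₗ[ℝ] E)) ?_
  rw [← LinearMap.ker_eq_bot, LinearMap.ker_eq_bot']
  exact fun v hv => eq_zero_of_apply_eq_zero_of_tendsto hM hv

theorem tendsto_exp_smul_adjoint_zero {M : E →L[ℝ] E}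
    (hM : Tendsto (fun t : ℝ => exp (t • M)) atTop (𝓝 0)) :
    Tendsto (fun t : ℝ => exp (t • adjoint M)) atTop (𝓝 0) := by
  rw [tendsto_zero_iff_norm_tendsto_zero] at hM ⊢
  simpa only [norm_exp_smul_adjoint] using hM

end Decay

/-! ### Riccati equation, steady state and turnpike estimate -/

namespace AffineLQR

variable {n m k l : ℕ} {D : AffineLQR n m k l} {P : Matrix (Fin n) (Fin n) ℝ}

variable (D P) in
/-- The closed-loop operator. -/
noncomputable def closedLoopOp : EuclideanSpace ℝ (Fin n) →L[ℝ] EuclideanSpace ℝ (Fin n) :=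
  euclideanOp (D.closedLoop P)

variable (D) in
/-- The operator `B B*`. -/
noncomputable def controlOp : EuclideanSpace ℝ (Fin n) →L[ℝ] EuclideanSpace ℝ (Fin n) :=
  (euclideanOp D.B).comp (adjoint (euclideanOp D.B))

theorem closedLoopOp_eq :
    D.closedLoopOp P = euclideanOp D.A - D.controlOp * euclideanOp P := by
  have h : euclideanOp (D.closedLoop P) =
      euclideanOp D.A - euclideanOp (D.B * D.B.transpose * P) := by
    simp [euclideanOp, closedLoop]
  rw [closedLoopOp, h, euclideanOp_mul, euclideanOp_mul, controlOp, adjoint_euclideanOp]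
  rfl

theorem riccati_op (h : D.A.transpose * P + P * D.A - P * D.B * D.B.transpose * P +
    D.C.transpose * D.C = 0) :
    adjoint (euclideanOp D.A) * euclideanOp P + euclideanOp P * euclideanOp D.A -
      euclideanOp P * D.controlOp * euclideanOp P +
      (adjoint (euclideanOp D.C)).comp (euclideanOp D.C) = 0 := by
  have h1 : euclideanOp (D.A.transpose * P) + euclideanOp (P * D.A) -
      euclideanOp (P * D.B * D.B.transpose * P) + euclideanOp (D.C.transpose * D.C) = 0 := by
    have := congrArg (euclideanOp (a := n) (b := n)) h
    simpa [euclideanOp] using this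
  rw [controlOp, adjoint_euclideanOp, adjoint_euclideanOp, adjoint_euclideanOp]
  rw [euclideanOp_mul, euclideanOp_mul, euclideanOp_mul, euclideanOp_mul, euclideanOp_mul,
    euclideanOp_mul] at h1
  exact h1

/-- A stabilizing solution of the Riccati equation is symmetric. -/
theorem transpose_eq_of_riccati (h : D.A.transpose * P + P * D.A - P * D.B * D.B.transpose * P +
    D.C.transpose * D.C = 0)
    (hM : Tendsto (fun t : ℝ => exp (t • D.closedLoopOp P)) atTop (𝓝 0)) :
    P.transpose = P := by
  have h' := congrArg Matrix.transpose h
  simp only [Matrix.transpose_add, Matrix.transpose_sub, Matrix.transpose_mul,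
    Matrix.transpose_transpose, Matrix.transpose_zero] at h'
  -- Subtracting the transposed Riccati equation leaves a homogeneous Lyapunov equation for `P -
  -- Pᵀ`.
  have hL : (D.closedLoop P).transpose * (P - P.transpose) +
      (P - P.transpose) * D.closedLoop P = 0 := by
    rw [← sub_eq_zero.2 (h.trans h'.symm)]
    simp only [closedLoop, Matrix.transpose_sub, Matrix.transpose_mul, Matrix.transpose_transpose,
      mul_sub, sub_mul, Matrix.mul_assoc]
    abel
  have hop : adjoint (D.closedLoopOp P) * euclideanOp (P - P.transpose) +
      euclideanOp (P - P.transpose) * D.closedLoopOp P = 0 := by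
    have h2 := congrArg (euclideanOp (a := n) (b := n)) hL
    rw [closedLoopOp, adjoint_euclideanOp]
    have h3 : euclideanOp ((D.closedLoop P).transpose * (P - P.transpose)) +
        euclideanOp ((P - P.transpose) * D.closedLoop P) = 0 := by
      simpa [euclideanOp] using h2
    rwa [euclideanOp_mul, euclideanOp_mul] at h3
  have h0 := eq_zero_of_lyapunov hM hop
  have h1 : P - P.transpose = 0 :=
    (LinearEquiv.map_eq_zero_iff _).1 ((LinearEquiv.map_eq_zero_iff _).1 h0)
  exact (sub_eq_zero.1 h1).symm

theorem adjoint_closedLoopOp (hP : P.transpose = P) :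
    adjoint (D.closedLoopOp P) = adjoint (euclideanOp D.A) - euclideanOp P * D.controlOp := by
  have h : (D.closedLoop P).transpose = D.A.transpose - P * (D.B * D.B.transpose) := by
    simp [closedLoop, Matrix.transpose_mul, hP, Matrix.mul_assoc]
  have h2 : euclideanOp (D.A.transpose - P * (D.B * D.B.transpose)) =
      euclideanOp D.A.transpose - euclideanOp (P * (D.B * D.B.transpose)) := by
    simp [euclideanOp]
  rw [closedLoopOp, adjoint_euclideanOp, h, h2, euclideanOp_mul, euclideanOp_mul, controlOp,
    adjoint_euclideanOp, adjoint_euclideanOp]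
  rfl

/-! ### The steady state -/

/-- With `ps = P xs + qs` the Riccati equation decouples the optimality system into `A₊* qs = C* yc`
and `A₊ xs = B B* qs`, both solvable by stability. -/
theorem exists_steady_costate (hric : D.A.transpose * P + P * D.A -
    P * D.B * D.B.transpose * P + D.C.transpose * D.C = 0)
    (hM : Tendsto (fun t : ℝ => exp (t • D.closedLoopOp P)) atTop (𝓝 0)) :
    ∃ xs ps, euclideanOp D.A xs = D.controlOp ps ∧
      adjoint (euclideanOp D.A) ps + adjoint (euclideanOp D.C) (euclideanOp D.C xs - D.yc) = 0 := by
  have hsymm := transpose_eq_of_riccati hric hM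
  obtain ⟨qs, hqs⟩ := surjective_of_tendsto_exp_smul_zero (tendsto_exp_smul_adjoint_zero hM)
    (adjoint (euclideanOp D.C) D.yc)
  obtain ⟨xs, hxs⟩ := surjective_of_tendsto_exp_smul_zero hM (D.controlOp qs)
  have hr := congrArg (fun T : EuclideanSpace ℝ (Fin n) →L[ℝ] EuclideanSpace ℝ (Fin n) => T xs)
    (riccati_op hric)
  rw [adjoint_closedLoopOp hsymm] at hqs
  rw [closedLoopOp_eq] at hxs
  simp only [add_apply, sub_apply, mul_apply_eq_comp,
    ContinuousLinearMap.comp_apply, zero_apply] at hr hqs hxs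
  have hA : euclideanOp D.A xs = D.controlOp (euclideanOp P xs + qs) := by
    rw [map_add, ← hxs]; abel
  refine ⟨xs, euclideanOp P xs + qs, hA, ?_⟩
  rw [map_add, map_sub, ← hqs]
  rw [hA, map_add, map_add] at hr
  rw [← hr]
  abel

/-- Here `ps` is the Lagrange multiplier: the linear terms add up to its pairing with the
constraint, which vanishes at both points. -/
theorem steadyCost_eq_of_costate {xs ps : EuclideanSpace ℝ (Fin n)}
    (hstate : euclideanOp D.A xs = D.controlOp ps)
    (hcostate : adjoint (euclideanOp D.A) ps +
      adjoint (euclideanOp D.C) (euclideanOp D.C xs - D.yc) = 0) :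
    D.IsSteadyState xs (-adjoint (euclideanOp D.B) ps) ∧ ∀ x' u', D.IsSteadyState x' u' →
      D.steadyCost x' u' = D.steadyCost xs (-adjoint (euclideanOp D.B) ps) +
        (1 / 2 * ‖euclideanOp D.C (x' - xs)‖ ^ 2 +
          1 / 2 * ‖u' + adjoint (euclideanOp D.B) ps‖ ^ 2) := by
  have hss : D.IsSteadyState xs (-adjoint (euclideanOp D.B) ps) := by
    rw [IsSteadyState, ← euclideanOp_apply, ← euclideanOp_apply, hstate, map_neg]
    exact add_neg_cancel _
  refine ⟨hss, fun x' u' h' => ?_⟩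
  rw [IsSteadyState, ← euclideanOp_apply, ← euclideanOp_apply] at h' hss
  simp only [steadyCost, ← euclideanOp_apply]
  set A := euclideanOp D.A
  set B := euclideanOp D.B
  set C := euclideanOp D.C
  set us := -adjoint B ps with hus
  have h1 := norm_add_sq_real (C xs - D.yc) (C (x' - xs))
  have h2 := norm_add_sq_real us (u' - us)
  rw [show C xs - D.yc + C (x' - xs) = C x' - D.yc by rw [map_sub]; abel] at h1
  rw [add_sub_cancel] at h2
  have hc1 : ⟪C xs - D.yc, C (x' - xs)⟫_ℝ = -⟪ps, A (x' - xs)⟫_ℝ := by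
    rw [← ContinuousLinearMap.adjoint_inner_left, ← ContinuousLinearMap.adjoint_inner_left,
      eq_neg_of_add_eq_zero_left hcostate, inner_neg_left, neg_neg]
  have hc2 : ⟪us, u' - us⟫_ℝ = -⟪ps, B (u' - us)⟫_ℝ := by
    rw [hus, inner_neg_left, ContinuousLinearMap.adjoint_inner_left]
  have hc3 : ⟪ps, A (x' - xs)⟫_ℝ + ⟪ps, B (u' - us)⟫_ℝ = 0 := by
    rw [← inner_add_right, show A (x' - xs) + B (u' - us) = (A x' + B u') - (A xs + B us) by
      rw [map_sub, map_sub]; abel, h', hss, sub_zero, inner_zero_right]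
  have hu : u' + adjoint B ps = u' - us := by rw [hus, sub_neg_eq_add]
  rw [hu]
  linarith

/-- This stands in for detectability in the uniqueness of `xs`. The Riccati equation gives `A₊* (P
v) = 0`, so `P v = 0`; then `A₊ v = 0`, so `v = 0`. -/
theorem eq_zero_of_unobservable_steady (hric : D.A.transpose * P + P * D.A -
    P * D.B * D.B.transpose * P + D.C.transpose * D.C = 0)
    (hM : Tendsto (fun t : ℝ => exp (t • D.closedLoopOp P)) atTop (𝓝 0))
    {v : EuclideanSpace ℝ (Fin n)} (hA : euclideanOp D.A v = 0) (hC : euclideanOp D.C v = 0) :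
    v = 0 := by
  have hsymm := transpose_eq_of_riccati hric hM
  have hr := congrArg (fun T : EuclideanSpace ℝ (Fin n) →L[ℝ] EuclideanSpace ℝ (Fin n) => T v)
    (riccati_op hric)
  simp only [add_apply, sub_apply, mul_apply_eq_comp,
    ContinuousLinearMap.comp_apply, zero_apply, hA, hC, map_zero, add_zero] at hr
  have hPv : euclideanOp P v = 0 := by
    refine eq_zero_of_apply_eq_zero_of_tendsto (tendsto_exp_smul_adjoint_zero hM) ?_
    rw [adjoint_closedLoopOp hsymm]
    exact hr
  refine eq_zero_of_apply_eq_zero_of_tendsto hM ?_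
  rw [closedLoopOp_eq, sub_apply, mul_apply_eq_comp, hPv, hA, map_zero, sub_zero]

/-- Existence and uniqueness for the steady-state problem. -/
theorem steady_optimal_unique (hric : D.A.transpose * P + P * D.A -
    P * D.B * D.B.transpose * P + D.C.transpose * D.C = 0)
    (hM : Tendsto (fun t : ℝ => exp (t • D.closedLoopOp P)) atTop (𝓝 0))
    {xs ps : EuclideanSpace ℝ (Fin n)}
    (hstate : euclideanOp D.A xs = D.controlOp ps)
    (hcostate : adjoint (euclideanOp D.A) ps +
      adjoint (euclideanOp D.C) (euclideanOp D.C xs - D.yc) = 0) :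
    D.IsSteadyOptimal xs (-adjoint (euclideanOp D.B) ps) ∧
      ∀ x' u', D.IsSteadyOptimal x' u' → x' = xs ∧ u' = -adjoint (euclideanOp D.B) ps := by
  obtain ⟨hss, hcost⟩ := steadyCost_eq_of_costate hstate hcostate
  refine ⟨⟨hss, fun x' u' h' => ?_⟩, fun x' u' h' => ?_⟩
  · rw [hcost x' u' h']
    exact le_add_of_nonneg_right (by positivity)
  · have hle := h'.2 _ _ hss
    rw [hcost x' u' h'.1] at hle
    have h1 : 0 ≤ ‖euclideanOp D.C (x' - xs)‖ ^ 2 := by positivity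
    have h2 : 0 ≤ ‖u' + adjoint (euclideanOp D.B) ps‖ ^ 2 := by positivity
    have hC : euclideanOp D.C (x' - xs) = 0 := by
      rw [← norm_eq_zero, ← sq_eq_zero_iff]; linarith
    have hu : u' + adjoint (euclideanOp D.B) ps = 0 := by
      rw [← norm_eq_zero, ← sq_eq_zero_iff]; linarith
    have hu' := eq_neg_of_add_eq_zero_left hu
    have h3 := h'.1
    rw [IsSteadyState, ← euclideanOp_apply, ← euclideanOp_apply] at h3 hss
    have hA : euclideanOp D.A (x' - xs) = 0 := by
      rw [map_sub, sub_eq_zero]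
      rw [hu', ← hss] at h3
      exact add_right_cancel h3
    exact ⟨sub_eq_zero.1 (eq_zero_of_unobservable_steady hric hM hA hC), hu'⟩

/-! ### Extremals via the closed loop -/

variable (D P) in
/-- The operator `F* F - P`. -/
noncomputable def terminalOp : EuclideanSpace ℝ (Fin n) →L[ℝ] EuclideanSpace ℝ (Fin n) :=
  (adjoint (euclideanOp D.F)).comp (euclideanOp D.F) - euclideanOp P

variable (D P) in
/-- The deviation of the extremal state from the steady state, in terms of its initial value `z₀`
and the terminal value `q₁` of the adjoint closed-loop variable. -/
noncomputable def stateDeviation (t₁ : ℝ) (z₀ q₁ : EuclideanSpace ℝ (Fin n)) (t : ℝ) :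
    EuclideanSpace ℝ (Fin n) :=
  exp (t • D.closedLoopOp P) z₀ - timeGramian (D.closedLoopOp P) D.controlOp t
    (exp ((t₁ - t) • adjoint (D.closedLoopOp P)) q₁)

/-- The term `W A₊*` of the Lyapunov equation cancels against the derivative of the backward
exponential. -/
theorem hasDerivAt_stateDeviation (t₁ : ℝ) (z₀ q₁ : EuclideanSpace ℝ (Fin n)) (t : ℝ) :
    HasDerivAt (D.stateDeviation P t₁ z₀ q₁)
      (D.closedLoopOp P (D.stateDeviation P t₁ z₀ q₁ t) -
        D.controlOp (exp ((t₁ - t) • adjoint (D.closedLoopOp P)) q₁)) t := by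
  have h1 := (hasDerivAt_exp_smul_const' (𝕂 := ℝ) (D.closedLoopOp P) t).clm_apply
    (hasDerivAt_const t z₀)
  have h2 := (hasDerivAt_timeGramian (D.closedLoopOp P) D.controlOp t).clm_apply
    (hasDerivAt_exp_sub_smul_apply (adjoint (D.closedLoopOp P)) t₁ q₁ t)
  refine (h1.sub h2).congr_deriv ?_
  simp only [stateDeviation, add_apply, mul_apply_eq_comp, map_sub, map_neg, map_zero, add_zero]
  abel

/-- The triangular form of the Hamiltonian system; `hq` is its terminal condition, solved for the
value of `q` at `t₁`. -/
theorem isExtremal_of_terminal (hric : D.A.transpose * P + P * D.A -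
    P * D.B * D.B.transpose * P + D.C.transpose * D.C = 0) (hsymm : P.transpose = P)
    {xs ps : EuclideanSpace ℝ (Fin n)}
    (hstate : euclideanOp D.A xs = D.controlOp ps)
    (hcostate : adjoint (euclideanOp D.A) ps +
      adjoint (euclideanOp D.C) (euclideanOp D.C xs - D.yc) = 0)
    {t₁ : ℝ} {q₁ : EuclideanSpace ℝ (Fin n)}
    (hq : q₁ = D.terminalOp P (D.stateDeviation P t₁ (D.x₀ - xs) q₁ t₁) +
      (adjoint (euclideanOp D.F) (euclideanOp D.F xs - D.ye) - ps)) :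
    D.IsExtremal t₁ (fun t => xs + D.stateDeviation P t₁ (D.x₀ - xs) q₁ t)
      (fun t => ps + (euclideanOp P (D.stateDeviation P t₁ (D.x₀ - xs) q₁ t) +
        exp ((t₁ - t) • adjoint (D.closedLoopOp P)) q₁)) where
  hasDerivAt_state t := by
    refine ((hasDerivAt_stateDeviation t₁ (D.x₀ - xs) q₁ t).const_add xs).congr_deriv ?_
    change _ = _ - D.controlOp _
    rw [map_add, map_add, map_add, hstate, closedLoopOp_eq, sub_apply, mul_apply_eq_comp]
    abel
  initial := by
    simp only [stateDeviation]
    rw [exp_zero_smul, timeGramian_zero, zero_apply, one_apply_eq_self, sub_zero, add_sub_cancel]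
  hasDerivAt_costate t := by
    set z := D.stateDeviation P t₁ (D.x₀ - xs) q₁ with hz
    have h1 := (euclideanOp P).hasFDerivAt.comp_hasDerivAt t
      (hasDerivAt_stateDeviation (D := D) (P := P) t₁ (D.x₀ - xs) q₁ t)
    have h2 := hasDerivAt_exp_sub_smul_apply (adjoint (D.closedLoopOp P)) t₁ q₁ t
    refine ((h1.add h2).const_add ps).congr_deriv ?_
    rw [← hz]
    generalize exp ((t₁ - t) • adjoint (D.closedLoopOp P)) q₁ = q
    have hr := congrArg (fun T : EuclideanSpace ℝ (Fin n) →L[ℝ] EuclideanSpace ℝ (Fin n) =>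
      T (z t)) (riccati_op hric)
    rw [adjoint_closedLoopOp hsymm, closedLoopOp_eq]
    simp only [add_apply, sub_apply, mul_apply_eq_comp, ContinuousLinearMap.comp_apply,
      zero_apply, map_add, map_sub] at hr hcostate ⊢
    rw [← sub_eq_zero]
    -- The residual is the steady costate equation plus the Riccati equation applied to `z t`.
    calc _ = (adjoint (euclideanOp D.A) ps + (adjoint (euclideanOp D.C) (euclideanOp D.C xs) -
          adjoint (euclideanOp D.C) D.yc)) +
        (adjoint (euclideanOp D.A) (euclideanOp P (z t)) + euclideanOp P (euclideanOp D.A (z t)) -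
          euclideanOp P (D.controlOp (euclideanOp P (z t))) +
          adjoint (euclideanOp D.C) (euclideanOp D.C (z t))) := by abel
      _ = 0 := by rw [hcostate, hr, add_zero]
  terminal := by
    simp only [sub_self, zero_smul, exp_zero, one_apply_eq_self]
    -- The first `q₁` sits inside the state deviation and must stay.
    nth_rewrite 2 [hq]
    simp only [terminalOp, sub_apply, ContinuousLinearMap.comp_apply, map_add, map_sub]
    abel

variable (D P) in
/-- The operator `I + (F* F - P) W(t)` whose inverse determines the terminal costate. -/
noncomputable def boundaryOp (t : ℝ) : EuclideanSpace ℝ (Fin n) →L[ℝ] EuclideanSpace ℝ (Fin n) :=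
  1 + D.terminalOp P * timeGramian (D.closedLoopOp P) D.controlOp t

/-- A kernel vector yields an extremal for zero initial value and zero targets. Uniqueness forces
its state to vanish at `t₁`, and the terminal condition then gives `q₁ = 0`. -/
theorem eq_zero_of_boundaryOp_eq_zero (hric : D.A.transpose * P + P * D.A -
    P * D.B * D.B.transpose * P + D.C.transpose * D.C = 0) (hsymm : P.transpose = P)
    {t₁ : ℝ} (ht : 0 ≤ t₁) {q₁ : EuclideanSpace ℝ (Fin n)} (hq : D.boundaryOp P t₁ q₁ = 0) :
    q₁ = 0 := by
  set D₀ : AffineLQR n m k l := { D with x₀ := 0, yc := 0, ye := 0 } with hD₀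
  have hz : q₁ = D₀.terminalOp P (D₀.stateDeviation P t₁ (D₀.x₀ - 0) q₁ t₁) +
      (adjoint (euclideanOp D₀.F) (euclideanOp D₀.F 0 - D₀.ye) - 0) := by
    have h1 : q₁ + D.terminalOp P (timeGramian (D.closedLoopOp P) D.controlOp t₁ q₁) = 0 := hq
    have h2 : D₀.stateDeviation P t₁ (D₀.x₀ - 0) q₁ t₁ =
        -timeGramian (D.closedLoopOp P) D.controlOp t₁ q₁ := by
      simp [stateDeviation, hD₀]
      rfl
    rw [h2]
    simp only [hD₀, map_zero, sub_zero, add_zero, map_neg]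
    exact eq_neg_of_add_eq_zero_left h1
  have hext := isExtremal_of_terminal (D := D₀) (P := P) hric hsymm (xs := 0) (ps := 0)
    (by simp) (by simp [hD₀]) hz
  have h0 : D₀.IsExtremal t₁ (fun _ => 0) (fun _ => 0) :=
    { hasDerivAt_state := fun t => by simpa using hasDerivAt_const t _
      initial := rfl
      hasDerivAt_costate := fun t => by simpa [hD₀] using hasDerivAt_const t _
      terminal := by simp [hD₀] }
  have hx := (h0.unique ht (hext.isOptimal ht)).1 (right_mem_Icc.2 ht)
  have hterm := hext.terminal
  simp only [zero_add] at hx hterm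
  rw [hx] at hterm
  simpa [hD₀] using hterm

theorem isUnit_boundaryOp (hric : D.A.transpose * P + P * D.A -
    P * D.B * D.B.transpose * P + D.C.transpose * D.C = 0) (hsymm : P.transpose = P)
    {t₁ : ℝ} (ht : 0 ≤ t₁) : IsUnit (D.boundaryOp P t₁) := by
  rw [ContinuousLinearMap.isUnit_iff_isUnit_toLinearMap, LinearMap.isUnit_iff_ker_eq_bot,
    LinearMap.ker_eq_bot']
  exact fun q hq => eq_zero_of_boundaryOp_eq_zero hric hsymm ht hq

/-- Matrix entries are continuous linear functionals, so the entrywise integral agrees with the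
operator-valued one. -/
theorem gramian_op {c r : ℝ} (hr : r < 0)
    (hM : ∀ t : ℝ, 0 ≤ t → ‖exp (t • D.closedLoopOp P)‖ ≤ c * Real.exp (r * t)) :
    euclideanOp (D.gramian P) = ∫ s in Ioi (0 : ℝ),
      exp (s • D.closedLoopOp P) * D.controlOp * exp (s • adjoint (D.closedLoopOp P)) := by
  set e := Matrix.toEuclideanCLM (n := Fin n) (𝕜 := ℝ) with he
  have hint := integrableOn_timeGramian_integrand (G := D.controlOp) hr hM
  have hop : ∀ s : ℝ, e (exp (s • D.closedLoop P) * D.B * D.B.transpose *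
      exp (s • (D.closedLoop P).transpose)) =
      exp (s • D.closedLoopOp P) * D.controlOp * exp (s • adjoint (D.closedLoopOp P)) := by
    intro s
    have hB : e (D.B * D.B.transpose) = D.controlOp := by
      rw [controlOp, adjoint_euclideanOp, ← euclideanOp_mul]
      rfl
    rw [closedLoopOp, adjoint_euclideanOp, Matrix.mul_assoc (exp _) D.B, map_mul, map_mul, hB,
      he, toEuclideanCLM_exp, toEuclideanCLM_exp, map_smul, map_smul]
    rfl
  have hW : D.gramian P = e.symm (∫ s in Ioi (0 : ℝ),
      exp (s • D.closedLoopOp P) * D.controlOp * exp (s • adjoint (D.closedLoopOp P))) := by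
    ext i j
    let φ : (EuclideanSpace ℝ (Fin n) →L[ℝ] EuclideanSpace ℝ (Fin n)) →L[ℝ] ℝ :=
      LinearMap.toContinuousLinearMap
        ((Matrix.entryLinearMap ℝ ℝ i j).comp e.symm.toAlgEquiv.toLinearMap)
    have h := φ.integral_comp_comm hint
    change _ = φ _
    rw [← h]
    refine integral_congr_ae (Eventually.of_forall fun s => ?_)
    change _ = e.symm _ i j
    rw [← hop s, StarAlgEquiv.symm_apply_apply]
  rw [hW]
  exact e.apply_symm_apply _

/-- The source of uniformity in the horizon. `det (1 + M N) = det (1 + N M)` carries `hW` over to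
the limit of `boundaryOp`. -/
theorem exists_bound_inverse_boundaryOp (hric : D.A.transpose * P + P * D.A -
    P * D.B * D.B.transpose * P + D.C.transpose * D.C = 0) (hsymm : P.transpose = P)
    (hW : IsUnit (1 + D.gramian P * (D.F.transpose * D.F - P)))
    {c r : ℝ} (hr : r < 0)
    (hM : ∀ t : ℝ, 0 ≤ t → ‖exp (t • D.closedLoopOp P)‖ ≤ c * Real.exp (r * t)) :
    ∃ K : ℝ, 0 < K ∧ ∀ t, 0 ≤ t → ‖Ring.inverse (D.boundaryOp P t)‖ ≤ K := by
  have hW' : IsUnit (1 + (D.F.transpose * D.F - P) * D.gramian P) := by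
    rw [Matrix.isUnit_iff_isUnit_det] at hW ⊢
    rwa [Matrix.det_one_add_mul_comm]
  have hop : Matrix.toEuclideanCLM (n := Fin n) (𝕜 := ℝ)
      (1 + (D.F.transpose * D.F - P) * D.gramian P) =
      1 + D.terminalOp P * ∫ s in Ioi (0 : ℝ),
        exp (s • D.closedLoopOp P) * D.controlOp * exp (s • adjoint (D.closedLoopOp P)) := by
    rw [map_add, map_one, map_mul, map_sub, ← gramian_op hr hM, terminalOp, adjoint_euclideanOp,
      ← euclideanOp_mul]
    rfl
  have hlim : Tendsto (D.boundaryOp P) atTop (𝓝 (1 + D.terminalOp P * ∫ s in Ioi (0 : ℝ),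
      exp (s • D.closedLoopOp P) * D.controlOp * exp (s • adjoint (D.closedLoopOp P)))) :=
    ((tendsto_timeGramian hr hM).const_mul _).const_add 1
  exact exists_bound_inverse_of_tendsto
    (continuous_const.add (continuous_const.mul (continuous_timeGramian _ _)))
    (fun t ht => isUnit_boundaryOp hric hsymm ht) (hop ▸ hW'.map _) hlim

/-- For every horizon there is an extremal, and the extremals satisfy the turnpike estimate with
any rate at which the closed-loop semigroup decays. -/
theorem exists_extremal_turnpike (hric : D.A.transpose * P + P * D.A -
    P * D.B * D.B.transpose * P + D.C.transpose * D.C = 0) (hsymm : P.transpose = P)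
    (hW : IsUnit (1 + D.gramian P * (D.F.transpose * D.F - P)))
    {xs ps : EuclideanSpace ℝ (Fin n)}
    (hstate : euclideanOp D.A xs = D.controlOp ps)
    (hcostate : adjoint (euclideanOp D.A) ps +
      adjoint (euclideanOp D.C) (euclideanOp D.C xs - D.yc) = 0)
    {c r : ℝ} (hr : r < 0)
    (hM : ∀ t : ℝ, 0 ≤ t → ‖exp (t • D.closedLoopOp P)‖ ≤ c * Real.exp (r * t)) :
    ∃ c' : ℝ, 0 < c' ∧ ∀ t₁ : ℝ, 0 < t₁ → ∃ x p, D.IsExtremal t₁ x p ∧ ∀ t ∈ Icc 0 t₁,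
      ‖x t - xs‖ ≤ c' * (Real.exp (r * t) + Real.exp (r * (t₁ - t))) ∧
      ‖-adjoint (euclideanOp D.B) (p t) - -adjoint (euclideanOp D.B) ps‖ ≤
        c' * (Real.exp (r * t) + Real.exp (r * (t₁ - t))) := by
  obtain ⟨K, hK0, hK⟩ := exists_bound_inverse_boundaryOp hric hsymm hW hr hM
  obtain ⟨w, hw0, hw⟩ := exists_bound_of_continuousOn_Ici_of_tendsto
    (continuous_timeGramian (D.closedLoopOp P) D.controlOp).continuousOn
    (tendsto_timeGramian hr hM)
  have hc : 0 ≤ c := by simpa using (norm_nonneg _).trans (hM 0 le_rfl)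
  set z₀ := D.x₀ - xs with hz₀
  set h := adjoint (euclideanOp D.F) (euclideanOp D.F xs - D.ye) - ps with hh
  -- `Q` bounds the solution `q₁` of the terminal equation for every horizon, using `exp (r t₁) ≤
  -- 1`.
  set Q := K * (‖D.terminalOp P‖ * (c * ‖z₀‖) + ‖h‖) with hQ
  have hQ0 : 0 ≤ Q := by positivity
  set c₁ := c * ‖z₀‖ + w * (c * Q) with hc₁
  have hc₁0 : 0 ≤ c₁ := by positivity
  set c₂ := ‖adjoint (euclideanOp D.B)‖ * (‖euclideanOp P‖ * c₁ + c * Q) with hc₂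
  have hc₂0 : 0 ≤ c₂ := by positivity
  refine ⟨c₁ + c₂ + 1, by positivity, fun t₁ ht₁ => ?_⟩
  set q₁ := Ring.inverse (D.boundaryOp P t₁)
    (D.terminalOp P (exp (t₁ • D.closedLoopOp P) z₀) + h) with hq₁
  have hq₁Q : ‖q₁‖ ≤ Q := by
    refine (ContinuousLinearMap.le_opNorm _ _).trans ?_
    refine mul_le_mul (hK t₁ ht₁.le) ((norm_add_le _ _).trans (add_le_add_left ?_ _))
      (norm_nonneg _) hK0.le
    refine (ContinuousLinearMap.le_opNorm _ _).trans (mul_le_mul_of_nonneg_left ?_ (norm_nonneg _))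
    refine (ContinuousLinearMap.le_opNorm _ _).trans
      (mul_le_mul_of_nonneg_right ?_ (norm_nonneg _))
    refine (hM t₁ ht₁.le).trans (mul_le_of_le_one_right hc (Real.exp_le_one_iff.2 ?_))
    exact mul_nonpos_of_nonpos_of_nonneg hr.le ht₁.le
  have hbdry : q₁ = D.terminalOp P (D.stateDeviation P t₁ z₀ q₁ t₁) + h := by
    have h1 := Ring.mul_inverse_cancel _ (isUnit_boundaryOp (D := D) hric hsymm ht₁.le)
    have h2 : D.boundaryOp P t₁ q₁ = D.terminalOp P (exp (t₁ • D.closedLoopOp P) z₀) + h := by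
      rw [hq₁, ← mul_apply_eq_comp, h1, one_apply_eq_self]
    rw [boundaryOp, add_apply, mul_apply_eq_comp, one_apply_eq_self] at h2
    rw [stateDeviation, sub_self, zero_smul, exp_zero, one_apply_eq_self, map_sub,
      sub_add_eq_add_sub, ← h2, add_sub_cancel_right]
  refine ⟨_, _, isExtremal_of_terminal hric hsymm hstate hcostate hbdry, fun t ht => ?_⟩
  rw [← hz₀]
  set e := Real.exp (r * t)
  set e' := Real.exp (r * (t₁ - t))
  have he : 0 < e := Real.exp_pos _
  have he' : 0 < e' := Real.exp_pos _
  set q := exp ((t₁ - t) • adjoint (D.closedLoopOp P)) q₁ with hq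
  have hqn : ‖q‖ ≤ c * Q * e' := by
    refine (ContinuousLinearMap.le_opNorm _ _).trans ?_
    rw [norm_exp_smul_adjoint, mul_right_comm]
    exact mul_le_mul (hM _ (sub_nonneg.2 ht.2)) hq₁Q (norm_nonneg _) (by positivity)
  have hz : ‖D.stateDeviation P t₁ z₀ q₁ t‖ ≤ c₁ * (e + e') := by
    have h1 : ‖exp (t • D.closedLoopOp P) z₀‖ ≤ c * e * ‖z₀‖ :=
      (ContinuousLinearMap.le_opNorm _ _).trans
        (mul_le_mul_of_nonneg_right (hM t ht.1) (norm_nonneg _))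
    have h2 : ‖timeGramian (D.closedLoopOp P) D.controlOp t q‖ ≤ w * (c * Q * e') :=
      (ContinuousLinearMap.le_opNorm _ _).trans (mul_le_mul (hw t ht.1) hqn (norm_nonneg _) hw0.le)
    -- The missing exponentials are added so that both terms become multiples of `e + e'`.
    have h3 : 0 ≤ c * ‖z₀‖ * e' := by positivity
    have h4 : 0 ≤ w * (c * Q) * e := by positivity
    calc _ ≤ c * e * ‖z₀‖ + w * (c * Q * e') := (norm_sub_le _ _).trans (add_le_add h1 h2)
      _ ≤ c * e * ‖z₀‖ + w * (c * Q * e') + (c * ‖z₀‖ * e' + w * (c * Q) * e) :=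
        le_add_of_nonneg_right (add_nonneg h3 h4)
      _ = _ := by rw [hc₁]; ring
  have hee : 0 ≤ e + e' := by positivity
  constructor
  · rw [add_sub_cancel_left]
    exact hz.trans (mul_le_mul_of_nonneg_right (by linarith) hee)
  · rw [neg_sub_neg, ← map_sub, sub_add_cancel_left, map_neg, norm_neg]
    have h1 : ‖euclideanOp P (D.stateDeviation P t₁ z₀ q₁ t) + q‖ ≤
        (‖euclideanOp P‖ * c₁ + c * Q) * (e + e') := by
      have h2 : ‖euclideanOp P (D.stateDeviation P t₁ z₀ q₁ t)‖ ≤ ‖euclideanOp P‖ * (c₁ * (e + e')) :=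
        (ContinuousLinearMap.le_opNorm _ _).trans (mul_le_mul_of_nonneg_left hz (norm_nonneg _))
      have h3 : 0 ≤ c * Q * e := by positivity
      calc _ ≤ ‖euclideanOp P‖ * (c₁ * (e + e')) + c * Q * e' :=
            (norm_add_le _ _).trans (add_le_add h2 hqn)
        _ ≤ ‖euclideanOp P‖ * (c₁ * (e + e')) + c * Q * e' + c * Q * e :=
          le_add_of_nonneg_right h3
        _ = _ := by ring
    calc _ ≤ ‖adjoint (euclideanOp D.B)‖ * ((‖euclideanOp P‖ * c₁ + c * Q) * (e + e')) :=
          (ContinuousLinearMap.le_opNorm _ _).trans (mul_le_mul_of_nonneg_left h1 (norm_nonneg _))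
      _ = c₂ * (e + e') := by rw [hc₂]; ring
      _ ≤ _ := mul_le_mul_of_nonneg_right (by linarith) hee

/-- Uniqueness transfers the bounds to every optimal pair; two continuous controls that agree almost
everywhere on `[0, t₁]` agree everywhere on it. -/
theorem turnpikeWithRate_of_decay (hric : D.A.transpose * P + P * D.A -
    P * D.B * D.B.transpose * P + D.C.transpose * D.C = 0) (hsymm : P.transpose = P)
    (hW : IsUnit (1 + D.gramian P * (D.F.transpose * D.F - P)))
    {xs ps : EuclideanSpace ℝ (Fin n)}
    (hstate : euclideanOp D.A xs = D.controlOp ps)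
    (hcostate : adjoint (euclideanOp D.A) ps +
      adjoint (euclideanOp D.C) (euclideanOp D.C xs - D.yc) = 0)
    {c r : ℝ} (hr : r < 0)
    (hM : ∀ t : ℝ, 0 ≤ t → ‖exp (t • D.closedLoopOp P)‖ ≤ c * Real.exp (r * t)) :
    D.TurnpikeWithRate xs (-adjoint (euclideanOp D.B) ps) r := by
  obtain ⟨c', hc', h⟩ := exists_extremal_turnpike hric hsymm hW hstate hcostate hr hM
  refine ⟨c', hc', fun t₁ ht₁ x' u' hopt => ?_⟩
  obtain ⟨x, p, hext, hbound⟩ := h t₁ ht₁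
  obtain ⟨hx, hu⟩ := hext.unique ht₁.le hopt
  refine ⟨fun t ht => hx ht ▸ (hbound t ht).1, ?_, fun hcont t ht => ?_⟩
  · filter_upwards [hu, ae_restrict_mem measurableSet_Icc] with t hut ht
    rw [hut]
    exact (hbound t ht).2
  · rw [Measure.eqOn_Icc_of_ae_eq volume ht₁.ne hu hcont hext.continuous_control.continuousOn ht]
    exact (hbound t ht).2

end AffineLQR

theorem mainTheorem1 {n m k l : ℕ} (hn : 0 < n) (D : AffineLQR n m k l)
    (P : Matrix (Fin n) (Fin n) ℝ) (hP : D.IsStabilizingSolution P)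
    (hW : IsUnit (1 + D.gramian P * (D.F.transpose * D.F - P))) :
    -- the rate is negative
    spectralAbscissa (D.closedLoop P) < 0 ∧
    -- the finite horizon problems have an essentially unique solution, with continuous control
    (∀ t₁ : ℝ, 0 < t₁ → ∃ x u, D.IsOptimal t₁ x u ∧ ContinuousOn u (Set.Icc 0 t₁) ∧
      ∀ x' u', D.IsOptimal t₁ x' u' → Set.EqOn x' x (Set.Icc 0 t₁) ∧
        u' =ᵐ[MeasureTheory.volume.restrict (Set.Icc 0 t₁)] u) ∧
    -- the steady-state problem has a unique solution, which is the turnpike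
    ∃ xs us, D.IsSteadyOptimal xs us ∧
      (∀ x' u', D.IsSteadyOptimal x' u' → x' = xs ∧ u' = us) ∧
      (∀ r : ℝ, spectralAbscissa (D.closedLoop P) < r → r < 0 → D.TurnpikeWithRate xs us r) ∧
      (HasSemisimpleAbscissa (D.closedLoop P) →
        D.TurnpikeWithRate xs us (spectralAbscissa (D.closedLoop P))) := by
  obtain ⟨hric, hstable⟩ := hP
  have hneg := spectralAbscissa_neg hn hstable
  -- An auxiliary rate suffices for existence, uniqueness and the steady state, none of which
  -- depends on it; the turnpike rates enter separately.
  obtain ⟨r, hr1, hr0⟩ := exists_between hneg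
  obtain ⟨c, -, hM⟩ := exists_norm_exp_smul_le (Or.inl hr1)
  have hlim : Tendsto (fun t : ℝ => exp (t • D.closedLoopOp P)) atTop (𝓝 0) :=
    tendsto_exp_smul_zero hr0 hM
  have hsymm := AffineLQR.transpose_eq_of_riccati hric hlim
  obtain ⟨xs, ps, hstate, hcostate⟩ := AffineLQR.exists_steady_costate hric hlim
  obtain ⟨hopt, huniq⟩ := AffineLQR.steady_optimal_unique hric hlim hstate hcostate
  refine ⟨hneg, fun t₁ ht₁ => ?_, xs, _, hopt, huniq, fun r' hr' hr'0 => ?_, fun hss => ?_⟩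
  · obtain ⟨c', -, h⟩ :=
      AffineLQR.exists_extremal_turnpike hric hsymm hW hstate hcostate hr0 hM
    obtain ⟨x, p, hext, -⟩ := h t₁ ht₁
    exact ⟨x, _, hext.isOptimal ht₁.le, hext.continuous_control.continuousOn,
      fun x' u' h' => hext.unique ht₁.le h'⟩
  · obtain ⟨c', -, hM'⟩ := exists_norm_exp_smul_le (Or.inl hr')
    exact AffineLQR.turnpikeWithRate_of_decay hric hsymm hW hstate hcostate hr'0 hM'
  · obtain ⟨c', -, hM'⟩ := exists_norm_exp_smul_le (Or.inr ⟨rfl, hss⟩)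
    exact AffineLQR.turnpikeWithRate_of_decay hric hsymm hW hstate hcostate hneg hM'
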